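/- Hackenbush is played on a finite graph with blue, red and green edges, some of whose vertices form the ground. Left cuts blue or green edges, Right cuts red or green edges, and whatever is no longer connected to the ground is discarded. Let $o^+$ and $o^-$ denote the outcome class ($\mathcal N$, $\mathcal P$, $\mathcal L$ or $\mathcal R$) under normal play (the last player to move wins) and under misère play (the last player to move loses). Let $+$ be the disjunctive sum, and let $*$ be a single green edge on the ground. A Generalized Flower of height $h\ge 1$ is a green path of length $h$, with one end on the ground, that supports at its other end a red-blue Hackenbush position, its Blossom. Its blossom value is the normal-play value (a dyadic rational) of the Blossom, that is, recursively, the simplest number lying strictly between the values of the left options and those of the right options. The Generalized Flower is blue, red, or a Stalk according as the blossom value is positive, negative or zero. (In particular, a Generalized Flower with empty Blossom is a Stalk.) A Generalized Sprig is a blue or red Generalized Flower of height $1$. A blue and a red Generalized Flower cancel if they have the same height and their blossom values sum to $0$. A Generalized Flowerbed is a disjunctive sum $F$ of finitely many Generalized Flowers and Stalks with equally many blue and red Generalized Flowers. A trimmed form $F_t$ of $F$ is what remains after canceling pairs have been removed until no two Generalized Flowers cancel. Put $F^*=F$ if some summand of $F$ has height at least $2$, and $F^*=F+*$ if all summands have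 height $1$. **Theorem 4.16.** Let $F$ be a Generalized Flowerbed with a trimmed form $F_t$ all of whose summands have height $1$, that is, $F_t$ consists of $n_t$ Generalized Sprigs of each color and of Stalks of height $1$. Let $\{x_i\}$ and $\{-y_j\}$ be the blossom values of the blue and of the red Generalized Sprigs in $F_t$, and let $\epsilon(F)=\min\{x_i\}-\min\{y_j\}$, where $\epsilon(F)=0$ if $n_t=0$. Let $a$ be the number of Stalks in $F$. Then $$o^+(F)=o^-(F^*)=o^+(F_t)=o^-(F_t+*)=\begin{cases}\mathcal N & \text{if } a \text{ is odd},\\ \mathcal P & \text{if } a \text{ is even and } \epsilon(F)=0,\\ \mathcal L & \text{if } a \text{ is even and } \epsilon(F)>0,\\ \mathcal R & \text{if } a \text{ is even and } \epsilon(F)<0.\end{cases}$$ In particular, $o^-(F)$ also has this value whenever some summand of $F$ has height at least $2$. -/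

import Mathlib

/-- The colours of the edges of a Hackenbush position. -/
inductive EdgeColor
  | blue
  | red
  | green

/-- The two players. -/
inductive Player
  | left
  | right

/-- The opponent of a player. -/
def Player.opp : Player → Player
  | .left => .right
  | .right => .left

/-- Left may cut blue and green edges, Right may cut red and green edges. -/
def Player.CanCut : Player → EdgeColor → Prop
  | .left, c => c = .blue ∨ c = .green
  | .right, c => c = .red ∨ c = .green

/-- Normal play: the last player to move wins. Misère play: the last player to move loses. -/
inductive Convention
  | normal
  | misere

/-- The four outcome classes: next player, previous player, Left, Right. -/
inductive Outcome
  | N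
  | P
  | L
  | R

/-- A finite multigraph (loops and parallel edges allowed) with coloured edges, in which a set of
vertices is designated to be the ground. -/
structure Hackenbush where
  V : Type
  E : Type
  finV : Finite V
  finE : Fintype E
  ends : E → Sym2 V
  color : E → EdgeColor
  ground : Set V

attribute [instance] Hackenbush.finV Hackenbush.finE

namespace Hackenbush

/-- `G.Grounded S v`: the vertex `v` is connected to the ground by edges of `S`. -/
inductive Grounded (G : Hackenbush) (S : Finset G.E) : G.V → Prop
  | base (v : G.V) (hv : v ∈ G.ground) : Grounded G S v
  | step (u v : G.V) (e : G.E) (he : e ∈ S) (huv : G.ends e = s(u, v)) (hu : Grounded G S u) :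
      Grounded G S v

open Classical in
/-- Discard the edges of `S` that are not connected to the ground. -/
noncomputable def prune (G : Hackenbush) (S : Finset G.E) : Finset G.E :=
  S.filter fun e => ∃ v ∈ G.ends e, G.Grounded S v

open Classical in
/-- The set of edges that remains when the edge `e` of `S` is cut. -/
noncomputable def cut (G : Hackenbush) (S : Finset G.E) (e : G.E) : Finset G.E :=
  G.prune (S.erase e)

theorem card_cut_lt (G : Hackenbush) {S : Finset G.E} {e : G.E} (he : e ∈ S) :
    (G.cut S e).card < S.card := by
  classical
  refine lt_of_le_of_lt (Finset.card_le_card (Finset.filter_subset _ _)) ?_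
  convert Finset.card_erase_lt_of_mem he

/-- The set of edges with which play starts. -/
noncomputable def start (G : Hackenbush) : Finset G.E :=
  G.prune Finset.univ

/-- `G.WinsFirst c p S`: when the edges in `S` remain and player `p` is to move, `p` wins under the
convention `c`. A player who cannot move loses under normal play and wins under misère play. -/
def WinsFirst (G : Hackenbush) (c : Convention) (p : Player) (S : Finset G.E) : Prop :=
  (c = .misere ∧ ∀ e ∈ S, ¬ p.CanCut (G.color e)) ∨
    ∃ e, ∃ _ : e ∈ S, p.CanCut (G.color e) ∧ ¬ WinsFirst G c p.opp (G.cut S e)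
termination_by S.card
decreasing_by exact G.card_cut_lt ‹_›

open Classical in
/-- The outcome of a Hackenbush position under a convention. -/
noncomputable def outcome (G : Hackenbush) (c : Convention) : Outcome :=
  if G.WinsFirst c .left G.start then
    if G.WinsFirst c .right G.start then .N else .L
  else
    if G.WinsFirst c .right G.start then .R else .P

end Hackenbush

/-- `x` is a dyadic rational with `l < x` for all `l ∈ A` and `x < r` for all `r ∈ B`. -/
def DyadicBetween (A B : Set ℚ) (x : ℚ) : Prop :=
  (∃ k : ℕ, x.den = 2 ^ k) ∧ (∀ l ∈ A, l < x) ∧ ∀ r ∈ B, x < r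

/-- `x` is the simplest number between `A` and `B`: its denominator is as small as possible, and
among those its absolute value is as small as possible (the latter matters only for integers). -/
def IsSimplestBetween (A B : Set ℚ) (x : ℚ) : Prop :=
  DyadicBetween A B x ∧
    ∀ y, DyadicBetween A B y → x.den < y.den ∨ (x.den = y.den ∧ |x| ≤ |y|)

open Classical in
/-- The simplest number between `A` and `B` (`0` by convention if there is none). -/
noncomputable def simplestBetween (A B : Set ℚ) : ℚ :=
  if h : ∃ x, IsSimplestBetween A B x then h.choose else 0

namespace Hackenbush

/-- The normal-play value of the position with remaining edges `S`, meant for red-blue positions: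
the simplest number between the values of the left options and those of the right options. -/
noncomputable def valueAt (G : Hackenbush) (S : Finset G.E) : ℚ :=
  simplestBetween
    {x | ∃ e, ∃ _ : e ∈ S, Player.left.CanCut (G.color e) ∧ x = valueAt G (G.cut S e)}
    {x | ∃ e, ∃ _ : e ∈ S, Player.right.CanCut (G.color e) ∧ x = valueAt G (G.cut S e)}
termination_by S.card
decreasing_by all_goals exact G.card_cut_lt ‹_›

/-- The normal-play value of a red-blue Hackenbush position. -/
noncomputable def value (G : Hackenbush) : ℚ :=
  G.valueAt G.start

/-- No edge is green. -/
def IsRedBlue (G : Hackenbush) : Prop :=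
  ∀ e, G.color e ≠ .green

/-- The empty position. -/
def zero : Hackenbush where
  V := Empty
  E := Empty
  finV := inferInstance
  finE := inferInstance
  ends := fun e => e.elim
  color := fun e => e.elim
  ground := ∅

/-- The disjunctive sum: the disjoint union of the graphs, and of the grounds. -/
def add (G H : Hackenbush) : Hackenbush where
  V := G.V ⊕ H.V
  E := G.E ⊕ H.E
  finV := inferInstance
  finE := inferInstance
  ends := Sum.elim (fun e => (G.ends e).map Sum.inl) (fun e => (H.ends e).map Sum.inr)
  color := Sum.elim G.color H.color
  ground := Sum.inl '' G.ground ∪ Sum.inr '' H.ground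

open Classical in
/-- A green String of length `n` supporting `B`: the vertices of the String are `0, …, n`, where `0`
is the only ground vertex, and the ground vertices of `B` are all identified with the top vertex `n`
of the String. -/
noncomputable def onStem (n : ℕ) (B : Hackenbush) : Hackenbush where
  V := Fin (n + 1) ⊕ B.V
  E := Fin n ⊕ B.E
  finV := inferInstance
  finE := inferInstance
  ends := Sum.elim (fun i => s(Sum.inl i.castSucc, Sum.inl i.succ))
    (fun e => (B.ends e).map fun v => if v ∈ B.ground then Sum.inl (Fin.last n) else Sum.inr v)
  color := Sum.elim (fun _ => .green) B.color
  ground := {Sum.inl 0}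

/-- The Stalk of height `n`. -/
noncomputable def stalk (n : ℕ) : Hackenbush :=
  onStem n zero

/-- The game `*`. -/
noncomputable def star : Hackenbush :=
  stalk 1

end Hackenbush

/-- A Generalized Flower: a green String of positive length supporting a red-blue Hackenbush
position, its Blossom. -/
structure GenFlower where
  height : ℕ
  height_pos : 0 < height
  blossom : Hackenbush
  redBlue : blossom.IsRedBlue

namespace GenFlower

/-- The Hackenbush position of a Generalized Flower. -/
noncomputable def toHackenbush (f : GenFlower) : Hackenbush :=
  Hackenbush.onStem f.height f.blossom

/-- The blossom value. -/
noncomputable def value (f : GenFlower) : ℚ :=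
  f.blossom.value

def IsBlue (f : GenFlower) : Prop := 0 < f.value

def IsRed (f : GenFlower) : Prop := f.value < 0

/-- A Generalized Flower whose blossom value is zero, for instance one with an empty Blossom, counts
as a Stalk. -/
def IsStalk (f : GenFlower) : Prop := f.value = 0

/-- A blue and a red Generalized Flower of the same height and of opposite blossom values. -/
def Cancels (f g : GenFlower) : Prop :=
  f.IsBlue ∧ g.IsRed ∧ f.height = g.height ∧ f.value + g.value = 0

end GenFlower

/-- The disjunctive sum of a list of Generalized Flowers and Stalks. -/
noncomputable def flowerSum (F : List GenFlower) : Hackenbush :=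
  F.foldr (fun f G => f.toHackenbush.add G) Hackenbush.zero

open Classical in
noncomputable def blueFlowers (F : List GenFlower) : List GenFlower :=
  F.filter fun f => f.IsBlue

open Classical in
noncomputable def redFlowers (F : List GenFlower) : List GenFlower :=
  F.filter fun f => f.IsRed

open Classical in
/-- The number of Stalks. -/
noncomputable def numStalks (F : List GenFlower) : ℕ :=
  (F.filter fun f => f.IsStalk).length

/-- A Generalized Flowerbed has as many blue as red Generalized Flowers. -/
def IsFlowerbed (F : List GenFlower) : Prop :=
  (blueFlowers F).length = (redFlowers F).length

/-- `F'` is obtained from `F` by removing one pair of Generalized Flowers that cancel (the order of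
the summands is immaterial). -/
def RemovesPair (F F' : List GenFlower) : Prop :=
  ∃ f g, f.Cancels g ∧ F.Perm (f :: g :: F')

/-- `T` is obtained from `F` by removing pairs that cancel, and is minimal in this respect. -/
def IsTrimmedForm (F T : List GenFlower) : Prop :=
  Relation.ReflTransGen RemovesPair F T ∧ ∀ T', ¬ RemovesPair T T'

/-- The edge `min xᵢ - min yⱼ`, where the `xᵢ` are the blossom values of the blue, and the `-yⱼ`
those of the red Generalized Flowers; it is `0` if there are none of one colour. -/
noncomputable def flowerEdge (T : List GenFlower) : ℚ :=
  match ((blueFlowers T).map fun f => f.value).min?, ((redFlowers T).map fun f => -f.value).min? with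
  | some x, some y => x - y
  | _, _ => 0

open Classical in
/-- The evil twin `F*` of a sum of Generalized Flowers and Stalks: it is the sum itself if some
summand has height at least `2`, and otherwise one adds the game `*`. -/
noncomputable def evilTwin (F : List GenFlower) : Hackenbush :=
  if ∃ f ∈ F, 2 ≤ f.height then flowerSum F else (flowerSum F).add Hackenbush.star

/-- The outcome class determined by the number `a` of Stalks and the edge `ε`. -/
def predictedOutcome (a : ℕ) (ε : ℚ) : Outcome :=
  if a % 2 = 1 then .N
  else if ε = 0 then .P
  else if 0 < ε then .L
  else .R

/-! Play on the graph is translated into play on multisets of pairs (height, blossom), where a stem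
cut leaves a shorter bare path and a blossom move changes only the blossom. The theorem is then
proved for such multisets.

Blossoms matter only through their values. If two blossoms have positive total for a player, that
player has a blossom move keeping the total nonnegative (`Blossom.exists_move_of_add_pos`). Hence a
pair of equal height and nonnegative total can be answered move by move: stem cuts are copied,
blossom moves are compensated (`Paired.exists_reply`). A cancelling pair is such a pair for both
players, so trimming preserves the normal outcome.

When all heights are 1, signs are counted. A strict majority of favourable flowers wins for the
player to move (`wins_of_neg_lt_pos`). From a balanced sum the mover removes an unfavourable flower,
and the opponent must remove a favourable one or lose by majority. These exchanges preserve the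
parity of the number of summands, which is the parity of the number of Stalks. With an odd number,
the last exchange leaves an odd number of zero-valued flowers and the mover wins (`wins_of_odd`).
With an even number, the winner is the player who can keep to the end an opposing flower that is
outweighed by every flower of the player's own (`Ahead`). The sign of the edge says who this is.
After trimming the edge vanishes only when no colored flower is left, since the two minimal flowers
would otherwise cancel.

Misère play is compared with normal play in two regimes. With all heights 1, adding a star exchanges
the two conventions (`misere_wins_iff_of_allOne`). With a flower of height at least 2 they agree
(`misere_wins_iff_of_tall`), because whoever cuts down the last tall stem may choose whether a star
remains. -/

theorem Player.opp_opp (p : Player) : p.opp.opp = p := by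
  cases p <;> rfl

/-! ### Pruning and the commutation of cuts. -/

namespace Hackenbush

variable {G : Hackenbush}

theorem mem_prune {S : Finset G.E} {e : G.E} :
    e ∈ G.prune S ↔ e ∈ S ∧ ∃ v ∈ G.ends e, G.Grounded S v := by
  simp [prune]

theorem prune_subset (S : Finset G.E) : G.prune S ⊆ S := fun _ he => (mem_prune.1 he).1

theorem Grounded.mono {S T : Finset G.E} (h : S ⊆ T) {v : G.V} (hv : G.Grounded S v) :
    G.Grounded T v := by
  induction hv with
  | base v hv => exact .base v hv
  | step u v e he huv _ ih => exact .step u v e (h he) huv ih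

theorem prune_mono {S T : Finset G.E} (h : S ⊆ T) : G.prune S ⊆ G.prune T := fun e he => by
  obtain ⟨h1, v, hv, h2⟩ := mem_prune.1 he
  exact mem_prune.2 ⟨h h1, v, hv, h2.mono h⟩

theorem Grounded.prune {S : Finset G.E} {v : G.V} (hv : G.Grounded S v) :
    G.Grounded (G.prune S) v := by
  induction hv with
  | base v hv => exact .base v hv
  | step u v e he huv hu ih =>
    exact .step u v e (mem_prune.2 ⟨he, u, by simp [huv], hu⟩) huv ih

theorem prune_prune (S : Finset G.E) : G.prune (G.prune S) = G.prune S := by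
  refine (prune_subset _).antisymm fun e he => ?_
  obtain ⟨_, v, hv, h2⟩ := mem_prune.1 he
  exact mem_prune.2 ⟨he, v, hv, h2.prune⟩

-- A path that supports an edge after the erasure supported it before, so early discarding loses
-- nothing. Hence successive cuts depend only on the set of edges cut.
open Classical in
theorem prune_erase_prune (S : Finset G.E) (e : G.E) :
    G.prune ((G.prune S).erase e) = G.prune (S.erase e) := by
  refine (prune_mono (Finset.erase_subset_erase _ (prune_subset _))).antisymm fun f hf => ?_
  have key : ∀ v, G.Grounded (S.erase e) v → G.Grounded ((G.prune S).erase e) v := by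
    intro v hv
    induction hv with
    | base v hv => exact .base v hv
    | step u v e' he huv hu ih =>
      refine .step u v e' ?_ huv ih
      have := Finset.mem_erase.1 he
      exact Finset.mem_erase.2 ⟨this.1, mem_prune.2
        ⟨this.2, u, by simp [huv], hu.mono (Finset.erase_subset _ _)⟩⟩
  obtain ⟨h1, v, hv, h2⟩ := mem_prune.1 hf
  have h3 := Finset.mem_erase.1 h1
  exact mem_prune.2 ⟨Finset.mem_erase.2 ⟨h3.1, mem_prune.2
    ⟨h3.2, v, hv, h2.mono (Finset.erase_subset _ _)⟩⟩, v, hv, key v h2⟩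

theorem prune_cut (S : Finset G.E) (e : G.E) : G.prune (G.cut S e) = G.cut S e :=
  prune_prune _

theorem prune_start : G.prune G.start = G.start := prune_prune _

open Classical in
theorem cut_comm (S : Finset G.E) (e f : G.E) : G.cut (G.cut S e) f = G.cut (G.cut S f) e := by
  have key : ∀ e f, G.cut (G.cut S e) f = G.prune ((S.erase e).erase f) := fun e f => by
    have := prune_erase_prune (S.erase e) f
    unfold cut
    convert this
  rw [key, key, Finset.erase_right_comm]

theorem cut_of_notMem {S : Finset G.E} (hS : G.prune S = S) {e : G.E} (he : e ∉ S) :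
    G.cut S e = S := by
  classical
  rw [cut, Finset.erase_eq_of_notMem he, hS]

/-- Follow a path from the ground towards `e`. Whichever of `e` and `f` is met first is supported
without using either edge, so it survives the cut of the other. -/
theorem mem_cut_or_mem_cut {S : Finset G.E} (hS : G.prune S = S) {e f : G.E} (he : e ∈ S)
    (hf : f ∈ S) (hne : e ≠ f) : f ∈ G.cut S e ∨ e ∈ G.cut S f := by
  classical
  set T := (S.erase e).erase f with hT
  have key : ∀ v, G.Grounded S v → G.Grounded T v ∨
      (∃ w ∈ G.ends e, G.Grounded T w) ∨ ∃ w ∈ G.ends f, G.Grounded T w := by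
    intro v hv
    induction hv with
    | base v hv => exact .inl (.base v hv)
    | step u v e' he' huv hu ih =>
      rcases ih with ih | ih
      · by_cases h1 : e' = e
        · subst h1
          exact .inr (.inl ⟨u, by simp [huv], ih⟩)
        by_cases h2 : e' = f
        · subst h2
          exact .inr (.inr ⟨u, by simp [huv], ih⟩)
        exact .inl (.step u v e' (by simp [hT, h1, h2, he']) huv ih)
      · exact .inr ih
  have h1 : T ⊆ S.erase e := Finset.erase_subset _ _
  have h2 : T ⊆ S.erase f := by
    rw [hT, Finset.erase_right_comm]
    exact Finset.erase_subset _ _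
  have h3 : (∃ w ∈ G.ends e, G.Grounded T w) ∨ ∃ w ∈ G.ends f, G.Grounded T w := by
    rw [← hS] at he
    obtain ⟨_, v, hv, hg⟩ := mem_prune.1 he
    rcases key v hg with h | h
    · exact .inl ⟨v, hv, h⟩
    · exact h
  rcases h3 with ⟨w, hw, hg⟩ | ⟨w, hw, hg⟩
  · right
    rw [cut]
    exact mem_prune.2 ⟨by simp [hne, he], w, hw, (hg.mono h2).mono (by intro; simp)⟩
  · left
    rw [cut]
    exact mem_prune.2 ⟨by simp [hne.symm, hf], w, hw, (hg.mono h1).mono (by intro; simp)⟩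

end Hackenbush

/-! ### Simplest numbers. -/

theorem exists_dyadic_between {a b : ℚ} (h : a < b) :
    ∃ x : ℚ, (∃ k : ℕ, x.den = 2 ^ k) ∧ a < x ∧ x < b := by
  obtain ⟨k, hk⟩ := exists_pow_lt_of_lt_one (sub_pos.2 h) (by norm_num : (1 / 2 : ℚ) < 1)
  have h2 : (0 : ℚ) < 2 ^ k := by positivity
  -- The first multiple of `1 / 2 ^ k` beyond `a`; the mesh is smaller than `b - a`.
  refine ⟨((⌊a * 2 ^ k⌋ + 1 : ℤ) : ℚ) / ((2 ^ k : ℤ) : ℚ), ?_, ?_, ?_⟩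
  · have h3 := Rat.den_dvd (⌊a * 2 ^ k⌋ + 1) (2 ^ k)
    obtain ⟨m, -, hm⟩ := (Nat.dvd_prime_pow Nat.prime_two).1
      (by exact_mod_cast h3 : (((⌊a * 2 ^ k⌋ + 1 : ℤ) : ℚ) / ((2 ^ k : ℤ) : ℚ)).den ∣ 2 ^ k)
    exact ⟨m, hm⟩
  · push_cast
    rw [lt_div_iff₀ h2]
    exact Int.lt_floor_add_one _
  · push_cast
    rw [div_lt_iff₀ h2]
    have h3 := Int.floor_le (a * 2 ^ k)
    have h4 : (b - a) * 2 ^ k > (1 / 2) ^ k * 2 ^ k := by gcongr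
    rw [← mul_pow] at h4
    norm_num at h4
    linarith

theorem exists_dyadicBetween {A B : Set ℚ} (hA : A.Finite) (hB : B.Finite)
    (h : ∀ l ∈ A, ∀ r ∈ B, l < r) : ∃ x, DyadicBetween A B x := by
  obtain ⟨a, b, hab, ha, hb⟩ : ∃ a b : ℚ, a < b ∧ (∀ l ∈ A, l ≤ a) ∧ ∀ r ∈ B, b ≤ r := by
    rcases A.eq_empty_or_nonempty with rfl | hA'
    · obtain ⟨b, hb⟩ := hB.bddBelow
      exact ⟨b - 1, b, by linarith, by simp, fun r hr => hb hr⟩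
    · obtain ⟨a, haA, ha⟩ := Set.exists_max_image A id hA hA'
      rcases B.eq_empty_or_nonempty with rfl | hB'
      · exact ⟨a, a + 1, by linarith, ha, by simp⟩
      · obtain ⟨b, hbB, hb⟩ := Set.exists_min_image B id hB hB'
        exact ⟨a, b, h a haA b hbB, ha, hb⟩
  obtain ⟨x, hx, h1, h2⟩ := exists_dyadic_between hab
  exact ⟨x, hx, fun l hl => (ha l hl).trans_lt h1, fun r hr => h2.trans_le (hb r hr)⟩

theorem Rat.abs_le_abs_of_natAbs_le {x y : ℚ} (hd : x.den = y.den)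
    (h : x.num.natAbs ≤ y.num.natAbs) : |x| ≤ |y| := by
  rw [Rat.abs_def, Rat.abs_def, hd, Rat.divInt_eq_div, Rat.divInt_eq_div]
  gcongr

/-- Minimise the pair (denominator, absolute numerator) lexicographically; at equal denominators the
numerators order the absolute values. -/
theorem exists_isSimplestBetween {A B : Set ℚ} (hA : A.Finite) (hB : B.Finite)
    (h : ∀ l ∈ A, ∀ r ∈ B, l < r) : ∃ x, IsSimplestBetween A B x := by
  obtain ⟨x, hx, hmin⟩ := (InvImage.wf (fun x : ℚ => toLex (x.den, x.num.natAbs))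
    wellFounded_lt).has_min {x | DyadicBetween A B x} (exists_dyadicBetween hA hB h)
  refine ⟨x, hx, fun y hy => ?_⟩
  have h1 := hmin y hy
  simp only [InvImage, Prod.Lex.toLex_lt_toLex, not_or, not_and, not_lt] at h1
  rcases h1.1.lt_or_eq with h2 | h2
  · exact .inl h2
  · exact .inr ⟨h2, Rat.abs_le_abs_of_natAbs_le h2 (h1.2 h2.symm)⟩

theorem isSimplestBetween_simplestBetween {A B : Set ℚ} (hA : A.Finite) (hB : B.Finite)
    (h : ∀ l ∈ A, ∀ r ∈ B, l < r) : IsSimplestBetween A B (simplestBetween A B) := by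
  have h1 := exists_isSimplestBetween hA hB h
  rw [simplestBetween, dif_pos h1]
  exact h1.choose_spec

/-- Otherwise each number would lie in the interval of the other, so they would be equally simple,
hence opposite. Then `0` would lie in the first interval and be simpler than both. -/
theorem IsSimplestBetween.exists_of_lt {A B C D : Set ℚ} {x z : ℚ} (hx : IsSimplestBetween A B x)
    (hz : IsSimplestBetween C D z) (h : x < z) : (∃ b ∈ B, b ≤ z) ∨ ∃ c ∈ C, x ≤ c := by
  by_contra! hcon
  have h1 := hx.2 z ⟨hz.1.1, fun l hl => (hx.1.2.1 l hl).trans h, hcon.1⟩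
  have h2 := hz.2 x ⟨hx.1.1, hcon.2, fun r hr => h.trans (hz.1.2.2 r hr)⟩
  have h3 : |x| = |z| := by
    rcases h1 with h1 | h1 <;> rcases h2 with h2 | h2
    · omega
    · omega
    · omega
    · exact le_antisymm h1.2 h2.2
  rcases abs_eq_abs.1 h3 with h4 | h4
  · exact h.ne h4
  have hx0 : x < 0 := by linarith
  have hz0 : 0 < z := by linarith
  rcases hx.2 0 ⟨⟨0, by simp⟩, fun l hl => (hx.1.2.1 l hl).trans hx0,
    fun r hr => hz0.trans (hcon.1 r hr)⟩ with h5 | h5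
  · have := x.den_pos
    simp at h5
  · simp [hx0.ne] at h5

theorem DyadicBetween.neg {A B : Set ℚ} {x : ℚ} (h : DyadicBetween A B x) :
    DyadicBetween (-B) (-A) (-x) :=
  ⟨by simpa using h.1, fun l hl => by have := h.2.2 (-l) hl; linarith,
    fun r hr => by have := h.2.1 (-r) hr; linarith⟩

theorem IsSimplestBetween.neg {A B : Set ℚ} {x : ℚ} (h : IsSimplestBetween A B x) :
    IsSimplestBetween (-B) (-A) (-x) := by
  refine ⟨h.1.neg, fun y hy => ?_⟩
  have h1 := hy.neg
  rw [neg_neg, neg_neg] at h1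
  simpa using h.2 (-y) h1

/-! ### Values of red-blue positions. -/

namespace Hackenbush

variable {G : Hackenbush}

/-- The values of the options of a player. -/
def optionValues (G : Hackenbush) (p : Player) (S : Finset G.E) : Set ℚ :=
  {x | ∃ e ∈ S, p.CanCut (G.color e) ∧ x = G.valueAt (G.cut S e)}

theorem optionValues_finite (p : Player) (S : Finset G.E) : (G.optionValues p S).Finite := by
  refine (S.finite_toSet.image fun e => G.valueAt (G.cut S e)).subset ?_
  rintro x ⟨e, he, -, rfl⟩
  exact ⟨e, he, rfl⟩

theorem valueAt_eq (S : Finset G.E) :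
    G.valueAt S = simplestBetween (G.optionValues .left S) (G.optionValues .right S) := by
  rw [valueAt]
  simp only [optionValues, exists_prop]

/-- What must be shown is that left options lie below right options. The position after both cuts,
which does not depend on their order, separates the two options by induction. If one edge falls with
the other, that position coincides with one of the options; by `mem_cut_or_mem_cut` the remaining
inequality is still strict. -/
theorem isSimplestBetween_valueAt (hG : G.IsRedBlue) (S : Finset G.E) (hS : G.prune S = S) :
    IsSimplestBetween (G.optionValues .left S) (G.optionValues .right S) (G.valueAt S) := by
  induction hn : S.card using Nat.strong_induction_on generalizing S with
  | _ n ih =>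
  subst hn
  rw [valueAt_eq]
  refine isSimplestBetween_simplestBetween (optionValues_finite _ _) (optionValues_finite _ _) ?_
  rintro _ ⟨e, he, hce, rfl⟩ _ ⟨f, hf, hcf, rfl⟩
  have hne : e ≠ f := by
    rintro rfl
    have := hG e
    rcases hce with h | h <;> rcases hcf with h' | h' <;> simp_all
  have hE := ih _ (G.card_cut_lt he) (G.cut S e) (prune_cut _ _) rfl
  have hF := ih _ (G.card_cut_lt hf) (G.cut S f) (prune_cut _ _) rfl
  have h1 : f ∈ G.cut S e → G.valueAt (G.cut S e) < G.valueAt (G.cut (G.cut S e) f) := fun h =>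
    hE.1.2.2 _ ⟨f, h, hcf, rfl⟩
  have h2 : e ∈ G.cut S f → G.valueAt (G.cut (G.cut S f) e) < G.valueAt (G.cut S f) := fun h =>
    hF.1.2.1 _ ⟨e, h, hce, rfl⟩
  rw [cut_comm S f e] at h2
  by_cases hfe : f ∈ G.cut S e
  · by_cases hef : e ∈ G.cut S f
    · exact (h1 hfe).trans (h2 hef)
    · rw [cut_comm, cut_of_notMem (prune_cut _ _) hef] at h1
      exact h1 hfe
  · rw [cut_of_notMem (prune_cut _ _) hfe] at h2
    exact h2 ((mem_cut_or_mem_cut hS he hf hne).resolve_left hfe)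

end Hackenbush

/-! ### Blossoms and the moves their values provide. -/

/-- A position of red-blue Hackenbush without unsupported edges. -/
structure Blossom where
  graph : Hackenbush
  redBlue : graph.IsRedBlue
  edges : Finset graph.E
  pruned : graph.prune edges = edges

namespace Blossom

/-- The position after the edge `e` has been cut. -/
noncomputable def cut (x : Blossom) (e : x.graph.E) : Blossom :=
  ⟨x.graph, x.redBlue, x.graph.cut x.edges e, Hackenbush.prune_cut _ _⟩

/-- The moves of player `p`. -/
def Move (p : Player) (x y : Blossom) : Prop :=
  ∃ e ∈ x.edges, p.CanCut (x.graph.color e) ∧ y = x.cut e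

/-- The value of a position from the point of view of player `p`. -/
noncomputable def val (p : Player) (x : Blossom) : ℚ :=
  match p with
  | .left => x.graph.valueAt x.edges
  | .right => -x.graph.valueAt x.edges

/-- The empty position. -/
noncomputable def empty : Blossom :=
  ⟨.zero, fun e => e.elim, ∅, Finset.subset_empty.1 (Hackenbush.prune_subset _)⟩

theorem val_opp (p : Player) (x : Blossom) : x.val p.opp = -x.val p := by
  cases p <;> simp [val, Player.opp]

theorem isSimplestBetween_val (p : Player) (x : Blossom) :
    IsSimplestBetween {v | ∃ y, x.Move p y ∧ v = y.val p} {v | ∃ y, x.Move p.opp y ∧ v = y.val p}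
      (x.val p) := by
  have h := Hackenbush.isSimplestBetween_valueAt x.redBlue x.edges x.pruned
  cases p
  · change IsSimplestBetween _ _ (x.graph.valueAt x.edges)
    convert h using 1 <;>
    · ext v
      constructor
      · rintro ⟨_, ⟨e, he, hc, rfl⟩, rfl⟩
        exact ⟨e, he, hc, rfl⟩
      · rintro ⟨e, he, hc, rfl⟩
        exact ⟨_, ⟨e, he, hc, rfl⟩, rfl⟩
  · change IsSimplestBetween _ _ (-x.graph.valueAt x.edges)
    convert h.neg using 1 <;>
    · ext v
      constructor
      · rintro ⟨_, ⟨e, he, hc, rfl⟩, rfl⟩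
        exact ⟨e, he, hc, by simp [val, cut]⟩
      · rintro ⟨e, he, hc, h⟩
        exact ⟨_, ⟨e, he, hc, rfl⟩, by simp [val, cut, ← h]⟩

theorem Move.val_lt {p : Player} {x y : Blossom} (h : x.Move p y) : y.val p < x.val p :=
  (x.isSimplestBetween_val p).1.2.1 _ ⟨y, h, rfl⟩

theorem Move.lt_val {p : Player} {x y : Blossom} (h : x.Move p.opp y) : x.val p < y.val p :=
  (x.isSimplestBetween_val p).1.2.2 _ ⟨y, h, rfl⟩

/-- The strategic content of simplicity: a strict inequality leaves room for a move, on one side or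
the other, that does not reverse it. -/
theorem exists_move_of_lt {p : Player} {x z : Blossom} (h : x.val p < z.val p) :
    (∃ y, x.Move p.opp y ∧ y.val p ≤ z.val p) ∨ ∃ y, z.Move p y ∧ x.val p ≤ y.val p := by
  rcases (x.isSimplestBetween_val p).exists_of_lt (z.isSimplestBetween_val p) h with
    ⟨_, ⟨y, hy, rfl⟩, h⟩ | ⟨_, ⟨y, hy, rfl⟩, h⟩
  · exact .inl ⟨y, hy, h⟩
  · exact .inr ⟨y, hy, h⟩

/-- Compare `z` with the negative of `x`, in which the two players exchange their options. -/
theorem exists_move_of_add_pos {p : Player} {x z : Blossom} (h : 0 < x.val p + z.val p) :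
    (∃ y, x.Move p y ∧ 0 ≤ y.val p + z.val p) ∨ ∃ y, z.Move p y ∧ 0 ≤ x.val p + y.val p := by
  rcases (x.isSimplestBetween_val p).neg.exists_of_lt (z.isSimplestBetween_val p)
    (by linarith) with ⟨v, ⟨y, hy, hv⟩, h⟩ | ⟨_, ⟨y, hy, rfl⟩, h⟩
  · exact .inl ⟨y, hy, by linarith⟩
  · exact .inr ⟨y, hy, by linarith⟩

theorem not_move_empty {p : Player} {x : Blossom} : ¬ empty.Move p x := by
  rintro ⟨e, -⟩
  exact e.elim

theorem val_of_edges_eq_empty {x : Blossom} (p : Player) (hx : x.edges = ∅) : x.val p = 0 := by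
  rcases (x.isSimplestBetween_val p).2 0 ⟨⟨0, by simp⟩,
    by rintro _ ⟨y, ⟨e, he, -⟩, rfl⟩; simp [hx] at he,
    by rintro _ ⟨y, ⟨e, he, -⟩, rfl⟩; simp [hx] at he⟩ with h | h
  · have := (x.val p).den_pos
    simp at h
  · simpa using h.2

theorem val_empty (p : Player) : empty.val p = 0 := val_of_edges_eq_empty p rfl

theorem exists_move_of_pos {p : Player} {x : Blossom} (h : 0 < x.val p) :
    ∃ y, x.Move p y ∧ 0 ≤ y.val p := by
  rcases exists_move_of_lt (p := p) (x := empty) (z := x) (by rwa [val_empty]) with ⟨y, hy, -⟩ | ⟨y, hy, h⟩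
  · exact (not_move_empty hy).elim
  · exact ⟨y, hy, by rwa [val_empty] at h⟩

theorem Move.card_lt {p : Player} {x y : Blossom} (h : x.Move p y) :
    y.edges.card < x.edges.card := by
  obtain ⟨e, he, -, rfl⟩ := h
  exact x.graph.card_cut_lt he

end Blossom

/-! ### Sums of flowers as an abstract game. -/

/-- A green path of length `height` that supports a red-blue position. -/
structure FlowerPos where
  height : ℕ
  blossom : Blossom

namespace FlowerPos

/-- The bare path of length `k` as a sum of flowers: it is the empty sum for `k = 0`. -/
noncomputable def stub (k : ℕ) : Multiset FlowerPos :=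
  if k = 0 then 0 else {⟨k, .empty⟩}

/-- The moves of player `p` in a flower. -/
inductive Move (p : Player) : FlowerPos → Multiset FlowerPos → Prop
  | stem (h : ℕ) (x : Blossom) (k : ℕ) (hk : k < h) : Move p ⟨h, x⟩ (stub k)
  | blossom (h : ℕ) (x y : Blossom) (hxy : x.Move p y) : Move p ⟨h, x⟩ {⟨h, y⟩}

/-- The number of edges. -/
def size (c : FlowerPos) : ℕ := c.height + c.blossom.edges.card

/-- The value of the blossom from the point of view of `p`. -/
noncomputable def val (p : Player) (c : FlowerPos) : ℚ := c.blossom.val p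

end FlowerPos

namespace FlowerSum

open FlowerPos

/-- The moves of player `p` in a sum of flowers. -/
def Move (p : Player) (s t : Multiset FlowerPos) : Prop :=
  ∃ c r u, s = c ::ₘ r ∧ c.Move p u ∧ t = u + r

/-- The number of edges. -/
def size (s : Multiset FlowerPos) : ℕ := (s.map FlowerPos.size).sum

@[simp] theorem size_cons (c : FlowerPos) (s : Multiset FlowerPos) :
    size (c ::ₘ s) = c.size + size s := by simp [size]

@[simp] theorem size_add (s t : Multiset FlowerPos) : size (s + t) = size s + size t := by
  simp [size]

theorem size_stub (k : ℕ) : size (stub k) = k := by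
  unfold stub
  split_ifs with h
  · exact h.symm
  · simp [size, FlowerPos.size, Blossom.empty]

theorem size_lt_of_flower_move {p : Player} {c : FlowerPos} {u : Multiset FlowerPos}
    (h : c.Move p u) : size u < c.size := by
  cases h with
  | stem h x k hk => rw [size_stub, FlowerPos.size]; exact Nat.lt_add_right _ hk
  | blossom h x y hxy => simpa [size, FlowerPos.size] using hxy.card_lt

theorem Move.size_lt {p : Player} {s t : Multiset FlowerPos} (h : Move p s t) :
    size t < size s := by
  obtain ⟨c, r, u, rfl, hu, rfl⟩ := h
  have := size_lt_of_flower_move hu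
  simp only [size_add, size_cons]
  omega

theorem move_add_iff {p : Player} {s t w : Multiset FlowerPos} :
    Move p (s + t) w ↔ (∃ s', Move p s s' ∧ w = s' + t) ∨ ∃ t', Move p t t' ∧ w = s + t' := by
  constructor
  · rintro ⟨c, r, u, hst, hu, rfl⟩
    rcases Multiset.mem_add.1 (hst ▸ Multiset.mem_cons_self c r) with hc | hc
    · obtain ⟨q, rfl⟩ := Multiset.exists_cons_of_mem hc
      rw [Multiset.cons_add, Multiset.cons_inj_right] at hst
      exact .inl ⟨u + q, ⟨c, q, u, rfl, hu, rfl⟩, by rw [← hst, add_assoc]⟩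
    · obtain ⟨q, rfl⟩ := Multiset.exists_cons_of_mem hc
      rw [Multiset.add_cons, Multiset.cons_inj_right] at hst
      exact .inr ⟨u + q, ⟨c, q, u, rfl, hu, rfl⟩, by rw [← hst, add_left_comm]⟩
  · rintro (⟨_, ⟨c, r, u, rfl, hu, rfl⟩, rfl⟩ | ⟨_, ⟨c, r, u, rfl, hu, rfl⟩, rfl⟩)
    · exact ⟨c, r + t, u, by simp, hu, by rw [add_assoc]⟩
    · exact ⟨c, s + r, u, by simp, hu, by rw [add_left_comm]⟩

theorem move_singleton_iff {p : Player} {c : FlowerPos} {w : Multiset FlowerPos} :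
    Move p {c} w ↔ c.Move p w := by
  constructor
  · rintro ⟨c', r, u, h, hu, rfl⟩
    obtain ⟨rfl, rfl⟩ : c' = c ∧ r = 0 := by
      have h1 := congrArg Multiset.card h
      have h2 : r = 0 := by simpa using h1
      subst h2
      exact ⟨by simpa using h.symm, rfl⟩
    simpa using hu
  · exact fun h => ⟨c, 0, w, rfl, h, by simp⟩

theorem move_cons_iff {p : Player} {c : FlowerPos} {s w : Multiset FlowerPos} :
    Move p (c ::ₘ s) w ↔ (∃ u, c.Move p u ∧ w = u + s) ∨ ∃ s', Move p s s' ∧ w = c ::ₘ s' := by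
  rw [← Multiset.singleton_add, move_add_iff]
  simp [move_singleton_iff]

theorem not_move_zero {p : Player} {w : Multiset FlowerPos} : ¬ Move p 0 w := by
  rintro ⟨c, r, u, h, -⟩
  simp at h

/-- Player `p`, who is to move, wins. -/
def Wins (c : Convention) (p : Player) (s : Multiset FlowerPos) : Prop :=
  (c = .misere ∧ ∀ t, ¬ Move p s t) ∨ ∃ t, ∃ _ : Move p s t, ¬ Wins c p.opp t
termination_by size s
decreasing_by exact Move.size_lt ‹_›

/-- Player `p` wins under normal play if the opponent is to move. -/
def Nonneg (p : Player) (s : Multiset FlowerPos) : Prop := ¬ Wins .normal p.opp s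

variable {p : Player} {s t z : Multiset FlowerPos}

theorem wins_iff : Wins .normal p s ↔ ∃ t, Move p s t ∧ Nonneg p t := by
  rw [Wins]
  simp [Nonneg]

theorem nonneg_iff : Nonneg p s ↔ ∀ t, Move p.opp s t → Wins .normal p t := by
  rw [Nonneg, wins_iff]
  simp [Nonneg, Player.opp_opp]

/-! ### Pairs that can be answered move by move. -/

/-- The sum consists of pairs of flowers of the same height, the sum of whose blossom values is
not unfavourable to `p`. -/
inductive Paired (p : Player) : Multiset FlowerPos → Prop
  | zero : Paired p 0
  | cons (h : ℕ) (x y : Blossom) (s : Multiset FlowerPos) (hxy : 0 ≤ x.val p + y.val p)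
      (hs : Paired p s) : Paired p (⟨h, x⟩ ::ₘ ⟨h, y⟩ ::ₘ s)

theorem Paired.stub_add_stub (hs : Paired p s) (k : ℕ) : Paired p (stub k + (stub k + s)) := by
  unfold stub
  split_ifs with h
  · simpa
  · simpa using hs.cons k .empty .empty _ (by simp [Blossom.val_empty])

/-- A stem cut is copied on the partner. A blossom move of the opponent makes the total of the pair
strictly positive, which leaves `p` a compensating move in one of the two blossoms. -/
theorem Paired.exists_reply_aux (hs : Paired p s) {h : ℕ} {x y : Blossom}
    (hxy : 0 ≤ x.val p + y.val p) {u : Multiset FlowerPos}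
    (hu : FlowerPos.Move p.opp ⟨h, x⟩ u) :
    ∃ t, Move p (u + (⟨h, y⟩ ::ₘ s)) t ∧ Paired p t := by
  cases hu with
  | stem _ _ k hk =>
    exact ⟨_, move_add_iff.2 (.inr ⟨_, ⟨_, _, _, rfl, .stem h y k hk, rfl⟩, rfl⟩),
      hs.stub_add_stub k⟩
  | blossom _ _ x' hx =>
    rcases Blossom.exists_move_of_add_pos (p := p) (x := x') (z := y)
      (by have := hx.lt_val; linarith) with ⟨x'', hx', h1⟩ | ⟨y', hy, h1⟩
    · refine ⟨_, move_add_iff.2 (.inl ⟨_, move_singleton_iff.2 (.blossom _ _ _ hx'), rfl⟩), ?_⟩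
      rw [Multiset.singleton_add]
      exact hs.cons h x'' y s h1
    · refine ⟨_, move_add_iff.2 (.inr ⟨_, ⟨_, _, _, rfl, .blossom _ _ _ hy, rfl⟩, rfl⟩), ?_⟩
      rw [Multiset.singleton_add, Multiset.singleton_add]
      exact hs.cons h x' y' s h1

theorem Paired.exists_reply (hz : Paired p z) (h : Move p.opp z t) :
    ∃ t', Move p t t' ∧ Paired p t' := by
  induction hz generalizing t with
  | zero => exact (not_move_zero h).elim
  | cons n x y s hxy hs ih =>
    rcases move_cons_iff.1 h with ⟨u, hu, rfl⟩ | ⟨s', h', rfl⟩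
    · exact hs.exists_reply_aux hxy hu
    rcases move_cons_iff.1 h' with ⟨u, hu, rfl⟩ | ⟨s', h'', rfl⟩
    · rw [← Multiset.add_cons]
      exact hs.exists_reply_aux (by linarith) hu
    · obtain ⟨t', h1, h2⟩ := ih h''
      exact ⟨_, move_cons_iff.2 (.inr ⟨_, move_cons_iff.2 (.inr ⟨_, h1, rfl⟩), rfl⟩),
        h2.cons n x y _ hxy⟩

/-- Player `p` follows the winning strategy of `s` and answers every move in `z` inside `z`. -/
theorem Paired.add_aux (n : ℕ) : ∀ s z, size s + size z = n → Paired p z →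
    (Nonneg p s → Nonneg p (s + z)) ∧ (Wins .normal p s → Wins .normal p (s + z)) := by
  induction n using Nat.strong_induction_on with
  | _ n ih =>
  intro s z hn hz
  constructor
  · intro hs
    refine nonneg_iff.2 fun t ht => ?_
    rcases move_add_iff.1 ht with ⟨s', h, rfl⟩ | ⟨z', h, rfl⟩
    · exact (ih _ (by have := h.size_lt; omega) s' z rfl hz).2 (nonneg_iff.1 hs _ h)
    · obtain ⟨z'', h1, h2⟩ := hz.exists_reply h
      refine wins_iff.2 ⟨_, move_add_iff.2 (.inr ⟨_, h1, rfl⟩), ?_⟩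
      exact (ih _ (by have := h.size_lt; have := h1.size_lt; omega) s z'' rfl h2).1 hs
  · intro hs
    obtain ⟨s', h, h1⟩ := wins_iff.1 hs
    exact wins_iff.2 ⟨_, move_add_iff.2 (.inl ⟨_, h, rfl⟩),
      (ih _ (by have := h.size_lt; omega) s' z rfl hz).1 h1⟩

theorem Nonneg.add_paired (hs : Nonneg p s) (hz : Paired p z) : Nonneg p (s + z) :=
  (Paired.add_aux _ s z rfl hz).1 hs

theorem Wins.add_paired (hs : Wins .normal p s) (hz : Paired p z) : Wins .normal p (s + z) :=
  (Paired.add_aux _ s z rfl hz).2 hs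

theorem nonneg_zero : Nonneg p 0 := nonneg_iff.2 fun _ h => (not_move_zero h).elim

theorem Paired.nonneg (hs : Paired p s) : Nonneg p s := by
  simpa using nonneg_zero.add_paired hs

/-- The strategy for `x` is carried over to `y`. Whenever a blossom move makes the comparison
strict, `exists_move_of_lt` supplies either a move of the opponent in the worse blossom, to which
the old strategy has an answer, or a move of `p` in the better one, which restores the comparison.
-/
theorem mono_aux (h n : ℕ) : ∀ (x y : Blossom) s,
    x.edges.card + y.edges.card + size s = n → x.val p ≤ y.val p →
    (Nonneg p (⟨h, x⟩ ::ₘ s) → Nonneg p (⟨h, y⟩ ::ₘ s)) ∧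
      (Wins .normal p (⟨h, x⟩ ::ₘ s) → Wins .normal p (⟨h, y⟩ ::ₘ s)) := by
  induction n using Nat.strong_induction_on with
  | _ n ih =>
  intro x y s hn hxy
  constructor
  · intro hs
    refine nonneg_iff.2 fun t ht => ?_
    rw [nonneg_iff] at hs
    rcases move_cons_iff.1 ht with ⟨_, hu, rfl⟩ | ⟨s', hs', rfl⟩
    · cases hu with
      | stem _ _ k hk => exact hs _ (move_cons_iff.2 (.inl ⟨_, .stem _ _ k hk, rfl⟩))
      | blossom _ _ y' hy =>
        have hc := hy.card_lt
        rcases Blossom.exists_move_of_lt (hxy.trans_lt hy.lt_val) with ⟨x', hx, hle⟩ | ⟨y'', hy', hle⟩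
        · have := hx.card_lt
          exact (ih _ (by omega) x' y' s rfl hle).2
            (hs _ (move_cons_iff.2 (.inl ⟨_, .blossom _ _ _ hx, rfl⟩)))
        · have := hy'.card_lt
          exact wins_iff.2 ⟨_, move_cons_iff.2 (.inl ⟨_, .blossom _ _ _ hy', rfl⟩),
            (ih _ (by omega) x y'' s rfl hle).1 (nonneg_iff.2 hs)⟩
    · exact (ih _ (by have := hs'.size_lt; omega) x y s' rfl hxy).2
        (hs _ (move_cons_iff.2 (.inr ⟨_, hs', rfl⟩)))
  · intro hs
    obtain ⟨t, ht, hnn⟩ := wins_iff.1 hs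
    rcases move_cons_iff.1 ht with ⟨_, hu, rfl⟩ | ⟨s', hs', rfl⟩
    · cases hu with
      | stem _ _ k hk =>
        exact wins_iff.2 ⟨_, move_cons_iff.2 (.inl ⟨_, .stem _ _ k hk, rfl⟩), hnn⟩
      | blossom _ _ x' hx =>
        have hc := hx.card_lt
        rcases Blossom.exists_move_of_lt (hx.val_lt.trans_le hxy) with ⟨x'', hx', hle⟩ | ⟨y', hy, hle⟩
        · have := hx'.card_lt
          exact (ih _ (by omega) x'' y s rfl hle).2
            (nonneg_iff.1 hnn _ (move_cons_iff.2 (.inl ⟨_, .blossom _ _ _ hx', rfl⟩)))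
        · have := hy.card_lt
          exact wins_iff.2 ⟨_, move_cons_iff.2 (.inl ⟨_, .blossom _ _ _ hy, rfl⟩),
            (ih _ (by omega) x' y' s rfl hle).1 hnn⟩
    · exact wins_iff.2 ⟨_, move_cons_iff.2 (.inr ⟨_, hs', rfl⟩),
        (ih _ (by have := hs'.size_lt; omega) x y s' rfl hxy).1 hnn⟩

theorem Nonneg.mono {h : ℕ} {x y : Blossom} (hs : Nonneg p (⟨h, x⟩ ::ₘ s))
    (hxy : x.val p ≤ y.val p) : Nonneg p (⟨h, y⟩ ::ₘ s) :=
  (mono_aux h _ x y s rfl hxy).1 hs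

/-! ### Normal play at height one: counting signs. -/

/-- All flowers have height `1`. -/
def AllOne (s : Multiset FlowerPos) : Prop := ∀ c ∈ s, c.height = 1

@[simp] theorem allOne_cons {c : FlowerPos} : AllOne (c ::ₘ s) ↔ c.height = 1 ∧ AllOne s := by
  simp [AllOne]

theorem AllOne.move (hs : AllOne s) (h : Move p s t) : ∃ c r, s = c ::ₘ r ∧
    (t = r ∨ ∃ y, c.blossom.Move p y ∧ t = ⟨1, y⟩ ::ₘ r) := by
  obtain ⟨c, r, u, rfl, hu, rfl⟩ := h
  refine ⟨c, r, rfl, ?_⟩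
  cases hu with
  | stem h x k hk =>
    obtain rfl : h = 1 := (allOne_cons.1 hs).1
    obtain rfl : k = 0 := by omega
    exact .inl (by simp [stub])
  | blossom h x y hxy =>
    obtain rfl : h = 1 := (allOne_cons.1 hs).1
    exact .inr ⟨y, hxy, by simp⟩

theorem AllOne.of_move (hs : AllOne s) (h : Move p s t) : AllOne t := by
  obtain ⟨c, r, rfl, rfl | ⟨y, -, rfl⟩⟩ := hs.move h
  · exact (allOne_cons.1 hs).2
  · exact allOne_cons.2 ⟨rfl, (allOne_cons.1 hs).2⟩

theorem move_remove (p : Player) {c : FlowerPos} (h : 0 < c.height) : Move p (c ::ₘ s) s :=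
  ⟨c, s, _, rfl, .stem c.height c.blossom 0 h, by simp [stub]⟩

theorem wins_of_remove {c : FlowerPos} (h : 0 < c.height) (hs : Nonneg p s) :
    Wins .normal p (c ::ₘ s) :=
  wins_iff.2 ⟨_, move_remove p h, hs⟩

theorem wins_of_blossom {c : FlowerPos} {y : Blossom} (h : c.blossom.Move p y)
    (hs : Nonneg p (⟨c.height, y⟩ ::ₘ s)) : Wins .normal p (c ::ₘ s) :=
  wins_iff.2 ⟨_, ⟨c, s, _, rfl, .blossom c.height c.blossom y h, rfl⟩, by simpa using hs⟩

/-- When no value is negative, any pairing will do. -/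
theorem Paired.of_nonneg (hs : AllOne s) (h0 : ∀ c ∈ s, 0 ≤ c.val p) (he : Even s.card) :
    Paired p s := by
  induction hn : s.card using Nat.strong_induction_on generalizing s with
  | _ n ih =>
  subst hn
  rcases s.empty_or_exists_mem with rfl | ⟨c, hc⟩
  · exact .zero
  obtain ⟨r, rfl⟩ := Multiset.exists_cons_of_mem hc
  rcases r.empty_or_exists_mem with rfl | ⟨d, hd⟩
  · simp at he
  obtain ⟨q, rfl⟩ := Multiset.exists_cons_of_mem hd
  obtain ⟨n, x⟩ := c
  obtain ⟨m, y⟩ := d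
  simp only [allOne_cons] at hs
  obtain ⟨rfl, rfl, hq⟩ := hs
  refine .cons 1 x y q (add_nonneg (h0 ⟨1, x⟩ (by simp)) (h0 ⟨1, y⟩ (by simp))) ?_
  refine ih _ (by simp) hq (fun c hc => h0 c (by simp [hc])) ?_ rfl
  simpa [Nat.even_add_one] using he

/-- The number of blossoms of positive value from the point of view of `p`. -/
noncomputable def pos (p : Player) (s : Multiset FlowerPos) : ℕ := s.countP fun c => 0 < c.val p

/-- The number of blossoms of negative value from the point of view of `p`. -/
noncomputable def neg (p : Player) (s : Multiset FlowerPos) : ℕ := s.countP fun c => c.val p < 0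

theorem pos_cons (c : FlowerPos) :
    pos p (c ::ₘ s) = pos p s + if 0 < c.val p then 1 else 0 := by
  simp [pos, Multiset.countP_cons]

theorem neg_cons (c : FlowerPos) :
    neg p (c ::ₘ s) = neg p s + if c.val p < 0 then 1 else 0 := by
  simp [neg, Multiset.countP_cons]

theorem exists_cons_of_pos (h : 0 < pos p s) : ∃ c r, s = c ::ₘ r ∧ 0 < c.val p := by
  obtain ⟨c, hc, hv⟩ := Multiset.countP_pos.1 h
  obtain ⟨r, rfl⟩ := Multiset.exists_cons_of_mem hc
  exact ⟨c, r, rfl, hv⟩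

theorem exists_cons_of_neg (h : 0 < neg p s) : ∃ c r, s = c ::ₘ r ∧ c.val p < 0 := by
  obtain ⟨c, hc, hv⟩ := Multiset.countP_pos.1 h
  obtain ⟨r, rfl⟩ := Multiset.exists_cons_of_mem hc
  exact ⟨c, r, rfl, hv⟩

theorem nonneg_of_neg_eq_zero (h : neg p s = 0) : ∀ c ∈ s, 0 ≤ c.val p := by
  simpa [neg, Multiset.countP_eq_zero] using h

theorem pos_sub_neg_mono {c d : FlowerPos} (h : c.val p ≤ d.val p) :
    pos p (c ::ₘ s) ≤ pos p (d ::ₘ s) ∧ neg p (d ::ₘ s) ≤ neg p (c ::ₘ s) := by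
  simp only [pos_cons, neg_cons]
  constructor <;> split_ifs <;> first | omega | (exfalso; linarith)

theorem lt_val_of_move {c : FlowerPos} {y : Blossom} (h : c.blossom.Move p.opp y) :
    c.val p < (⟨1, y⟩ : FlowerPos).val p := h.lt_val

/-- Removing a negative flower turns a lead of one into a lead of two, and a move of the opponent
lowers the lead by at most one. The two claims feed each other until no negative flower is left. -/
theorem wins_nonneg_of_neg_lt_pos (n : ℕ) : ∀ s, size s = n → AllOne s →
    (neg p s + 1 ≤ pos p s → Wins .normal p s) ∧ (neg p s + 2 ≤ pos p s → Nonneg p s) := by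
  induction n using Nat.strong_induction_on with
  | _ n ih =>
  intro s hn hs
  constructor
  · intro h
    rcases Nat.eq_zero_or_pos (neg p s) with h0 | h0
    · have hnn := nonneg_of_neg_eq_zero h0
      obtain ⟨c, r, rfl, hc⟩ := exists_cons_of_pos (by omega : 0 < pos p s)
      have hs' := allOne_cons.1 hs
      -- Nothing is negative now, so it suffices to leave an even number of flowers: remove `c`, or
      -- else keep it by a blossom move to a nonnegative value.
      rcases Nat.even_or_odd r.card with he | ho
      · exact wins_of_remove (by omega) (Paired.of_nonneg hs'.2
          (fun c hc => hnn c (by simp [hc])) he).nonneg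
      · obtain ⟨y, hy, hy0⟩ := Blossom.exists_move_of_pos hc
        refine wins_of_blossom hy (Paired.of_nonneg (s := ⟨c.height, y⟩ ::ₘ r) (allOne_cons.2 ⟨hs'.1, hs'.2⟩) ?_ ?_).nonneg
        · intro d hd
          rcases Multiset.mem_cons.1 hd with rfl | hd
          · exact hy0
          · exact hnn d (by simp [hd])
        · simpa using ho.add_one
    · obtain ⟨c, r, rfl, hc⟩ := exists_cons_of_neg h0
      have hs' := allOne_cons.1 hs
      refine wins_of_remove (by omega) ((ih _ ?_ r rfl hs'.2).2 ?_)
      · rw [← hn, size_cons, FlowerPos.size]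
        omega
      · simp only [pos_cons, neg_cons, hc, hc.not_gt, if_true, if_false] at h
        omega
  · intro h
    refine nonneg_iff.2 fun t ht => (ih _ (hn ▸ ht.size_lt) t rfl (hs.of_move ht)).1 ?_
    obtain ⟨c, r, rfl, rfl | ⟨y, hy, rfl⟩⟩ := hs.move ht
    · rw [pos_cons, neg_cons] at h
      split_ifs at h <;> omega
    · have := pos_sub_neg_mono (s := r) (lt_val_of_move hy).le
      omega

theorem wins_of_neg_lt_pos (hs : AllOne s) (h : neg p s < pos p s) : Wins .normal p s :=
  (wins_nonneg_of_neg_lt_pos _ s rfl hs).1 h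

/-- Player `p` removes a negative flower. Unless the opponent removes a positive one, `p` has a
majority and the move; otherwise two summands are gone and the situation recurs. -/
theorem wins_of_odd (hs : AllOne s) (h : pos p s = neg p s) (ho : Odd s.card) :
    Wins .normal p s := by
  induction hn : size s using Nat.strong_induction_on generalizing s with
  | _ n ih =>
  rcases Nat.eq_zero_or_pos (neg p s) with h0 | h0
  · have hnn := nonneg_of_neg_eq_zero h0
    rcases s.empty_or_exists_mem with rfl | ⟨c, hc⟩
    · simp at ho
    obtain ⟨r, rfl⟩ := Multiset.exists_cons_of_mem hc
    have hs' := allOne_cons.1 hs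
    refine wins_of_remove (by omega)
      (Paired.of_nonneg hs'.2 (fun c hc => hnn c (by simp [hc])) ?_).nonneg
    simpa [Nat.odd_add_one] using ho
  · obtain ⟨c, r, rfl, hc⟩ := exists_cons_of_neg h0
    have hs' := allOne_cons.1 hs
    refine wins_of_remove (by omega) (nonneg_iff.2 fun t ht => ?_)
    simp only [pos_cons, neg_cons, hc, hc.not_gt, if_true, if_false] at h
    obtain ⟨d, q, rfl, rfl | ⟨y, hy, rfl⟩⟩ := hs'.2.move ht
    · rcases lt_or_ge 0 (d.val p) with hd | hd
      · refine ih _ ?_ (hs'.2.of_move ht) ?_ ?_ rfl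
        · rw [← hn, size_cons]
          have := ht.size_lt
          omega
        · simp only [pos_cons, neg_cons, hd, hd.not_gt, if_true, if_false] at h
          omega
        · simpa [Nat.odd_add_one] using ho
      · refine wins_of_neg_lt_pos (hs'.2.of_move ht) ?_
        simp only [pos_cons, neg_cons, hd.not_gt, if_false] at h
        omega
    · refine wins_of_neg_lt_pos (hs'.2.of_move ht) ?_
      have := pos_sub_neg_mono (s := q) (lt_val_of_move hy).le
      omega

/-! ### Balanced sums with an even number of summands. -/

/-- Some negative blossom is outweighed by every positive one. -/
def Ahead (p : Player) (s : Multiset FlowerPos) : Prop :=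
  ∃ c ∈ s, c.val p < 0 ∧ ∀ b ∈ s, 0 < b.val p → 0 < b.val p + c.val p

theorem zero_of_pos_neg (h1 : pos p s = 0) (h2 : neg p s = 0) : ∀ c ∈ s, c.val p = 0 := by
  intro c hc
  have h3 : ∀ c ∈ s, c.val p ≤ 0 := by
    simpa [pos, Multiset.countP_eq_zero] using h1
  exact le_antisymm (h3 c hc) (nonneg_of_neg_eq_zero h2 c hc)

/-- Player `p` removes negative flowers other than the distinguished `c`, and the opponent is forced
to remove positive ones. In the end `c` faces a single positive flower that outweighs it. -/
theorem Ahead.wins_of_even (hA : Ahead p s) (hs : AllOne s) (h : pos p s = neg p s)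
    (he : Even s.card) : Wins .normal p s := by
  induction hn : size s using Nat.strong_induction_on generalizing s with
  | _ n ih =>
  obtain ⟨c, hcs, hc, hb⟩ := hA
  obtain ⟨r, rfl⟩ := Multiset.exists_cons_of_mem hcs
  have hs' := allOne_cons.1 hs
  simp only [pos_cons, neg_cons, hc, hc.not_gt, if_true, if_false] at h
  rcases Nat.eq_zero_or_pos (neg p r) with h0 | h0
  · obtain ⟨b, q, rfl, hb0⟩ := exists_cons_of_pos (by omega : 0 < pos p r)
    have hq := zero_of_pos_neg (p := p) (s := q)
      (by simp only [pos_cons, hb0, if_true] at h; omega)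
      (by rw [neg_cons] at h0; omega)
    have hs2 := allOne_cons.1 hs'.2
    have hP : Paired p q := Paired.of_nonneg hs2.2 (fun c hc => (hq c hc).ge)
      (by simpa [Nat.even_add_one] using he)
    -- The strict surplus of `b` over `c` pays for one blossom move, after which the whole sum is
    -- paired.
    rcases Blossom.exists_move_of_add_pos (hb b (by simp) hb0) with ⟨y, hy, hy0⟩ | ⟨y, hy, hy0⟩
    · rw [Multiset.cons_swap]
      refine wins_of_blossom hy (Paired.nonneg ?_)
      rw [hs2.1]
      have := hP.cons 1 y c.blossom q hy0
      rwa [← hs'.1] at this ⊢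
    · refine wins_of_blossom hy (Paired.nonneg ?_)
      rw [hs'.1]
      have := hP.cons 1 y b.blossom q (by linarith)
      rwa [← hs2.1] at this ⊢
  · obtain ⟨d, q, rfl, hd⟩ := exists_cons_of_neg h0
    have hs2 := allOne_cons.1 hs'.2
    rw [Multiset.cons_swap]
    have hw : AllOne (c ::ₘ q) := allOne_cons.2 ⟨hs'.1, hs2.2⟩
    refine wins_of_remove (by omega) (nonneg_iff.2 fun t ht => ?_)
    have h' : pos p (c ::ₘ q) = neg p (c ::ₘ q) + 1 := by
      simp only [pos_cons, neg_cons, hc, hc.not_gt, hd, hd.not_gt, if_true, if_false] at h ⊢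
      omega
    obtain ⟨e, w, hew, rfl | ⟨y, hy, rfl⟩⟩ := hw.move ht
    · rw [hew] at h'
      rcases lt_or_ge 0 (e.val p) with he0 | he0
      · have hcw : c ∈ t := by
          have : c ∈ e ::ₘ t := hew ▸ Multiset.mem_cons_self c q
          rcases Multiset.mem_cons.1 this with rfl | h
          · exact (hc.not_gt he0).elim
          · exact h
        refine ih _ ?_ ⟨c, hcw, hc, fun b hbt => hb b ?_⟩ (hw.of_move ht) ?_ ?_ rfl
        · rw [← hn]
          have := ht.size_lt
          simp only [size_cons] at this ⊢
          omega
        · have : b ∈ c ::ₘ q := hew ▸ Multiset.mem_cons_of_mem hbt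
          rw [Multiset.mem_cons] at this
          rcases this with h | h <;> simp [h]
        · simp only [pos_cons, neg_cons, he0, he0.not_gt, if_true, if_false] at h'
          omega
        · have := congrArg Multiset.card hew
          simp only [Multiset.card_cons] at this he
          rw [this] at he
          simpa [Nat.even_add_one] using he
      · refine wins_of_neg_lt_pos (hw.of_move ht) ?_
        simp only [pos_cons, neg_cons, he0.not_gt, if_false] at h'
        omega
    · refine wins_of_neg_lt_pos (hw.of_move ht) ?_
      have := pos_sub_neg_mono (s := w) (lt_val_of_move hy).le
      rw [hew] at h'
      omega

theorem nonneg_of_even (hs : AllOne s) (h1 : pos p s = 0) (h2 : neg p s = 0)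
    (he : Even s.card) : Nonneg p s :=
  (Paired.of_nonneg hs (fun c hc => (zero_of_pos_neg h1 h2 c hc).ge) he).nonneg

/-- Removing a positive flower is answered by removing a negative one, `c` itself only as the last.
Removing a negative or a zero flower hands `p` a majority or a balanced odd sum. A blossom move by
the opponent gives `p` a majority or leaves `p` ahead and on move. -/
theorem Ahead.nonneg_of_even (hA : Ahead p s) (hs : AllOne s) (h : pos p s = neg p s)
    (he : Even s.card) : Nonneg p s := by
  induction hn : size s using Nat.strong_induction_on generalizing s with
  | _ n ih =>
  obtain ⟨c, hcs, hc, hb⟩ := hA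
  refine nonneg_iff.2 fun t ht => ?_
  have hsize := ht.size_lt
  have hone := hs.of_move ht
  obtain ⟨e, r, rfl, rfl | ⟨y, hy, rfl⟩⟩ := hs.move ht
  · rcases lt_trichotomy (e.val p) 0 with he0 | he0 | he0
    · refine wins_of_neg_lt_pos hone ?_
      simp only [pos_cons, neg_cons, he0, he0.not_gt, if_true, if_false] at h
      omega
    · refine wins_of_odd hone ?_ (by simpa [Nat.even_add_one] using he)
      simpa [pos_cons, neg_cons, he0] using h
    · simp only [pos_cons, neg_cons, he0, he0.not_gt, if_true, if_false] at h
      have hct : c ∈ t := by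
        rcases Multiset.mem_cons.1 hcs with rfl | h
        · exact (hc.not_gt he0).elim
        · exact h
      obtain ⟨q, rfl⟩ := Multiset.exists_cons_of_mem hct
      have hone' := allOne_cons.1 hone
      simp only [pos_cons, neg_cons, hc, hc.not_gt, if_true, if_false] at h
      rcases Nat.eq_zero_or_pos (neg p q) with h0 | h0
      · refine wins_of_remove (by omega) (FlowerSum.nonneg_of_even hone'.2 (by omega) h0 ?_)
        simpa [Nat.even_add_one] using he
      · obtain ⟨d, q, rfl, hd⟩ := exists_cons_of_neg h0
        have hone2 := allOne_cons.1 hone'.2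
        rw [Multiset.cons_swap]
        refine wins_of_remove (by omega) (ih _ ?_ ⟨c, by simp, hc, fun b hbt => hb b ?_⟩
          (allOne_cons.2 ⟨hone'.1, hone2.2⟩) ?_ ?_ rfl)
        · simp only [size_cons] at hsize hn ⊢
          omega
        · rw [Multiset.mem_cons] at hbt
          rcases hbt with h | h <;> simp [h]
        · simp only [pos_cons, neg_cons, hc, hc.not_gt, hd, hd.not_gt, if_true, if_false] at h ⊢
          omega
        · simpa [Nat.even_add_one] using he
  · have hlt := lt_val_of_move hy
    have hm := pos_sub_neg_mono (s := r) hlt.le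
    by_cases hD : neg p (⟨1, y⟩ ::ₘ r) < pos p (⟨1, y⟩ ::ₘ r)
    · exact wins_of_neg_lt_pos hone hD
    refine Ahead.wins_of_even ?_ hone (by omega) (by simpa using he)
    -- The blossom move raised the value of `e` for `p`. Without a resulting majority it cannot have
    -- made a positive flower or unmade a negative one.
    have hsign : 0 < (⟨1, y⟩ : FlowerPos).val p → 0 < e.val p := by
      intro hy0
      by_contra he0
      simp only [pos_cons, neg_cons, he0, hy0, hy0.not_gt, if_true, if_false] at h hD
      omega
    have hsign' : e.val p < 0 → (⟨1, y⟩ : FlowerPos).val p < 0 := by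
      intro he0
      by_contra hy0
      simp only [pos_cons, neg_cons, he0, he0.not_gt, hy0, if_true, if_false] at h hD
      omega
    have key : ∀ b ∈ (⟨1, y⟩ : FlowerPos) ::ₘ r, 0 < b.val p → 0 < b.val p + c.val p := by
      intro b hbt hb0
      rcases Multiset.mem_cons.1 hbt with rfl | hbt
      · have := hb e (by simp) (hsign hb0)
        linarith
      · exact hb b (by simp [hbt]) hb0
    rcases Multiset.mem_cons.1 hcs with rfl | hcr
    · exact ⟨⟨1, y⟩, by simp, hsign' hc, fun b hbt hb0 => by have := key b hbt hb0; linarith⟩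
    · exact ⟨c, by simp [hcr], hc, key⟩

end FlowerSum

/-! ### Misère play against normal play. -/

namespace FlowerSum

open FlowerPos

variable {p : Player} {s t : Multiset FlowerPos}

/-- The game `*`. -/
noncomputable def star : FlowerPos := ⟨1, .empty⟩

theorem star_val (p : Player) : star.val p = 0 := Blossom.val_empty p

theorem move_star_cons_iff {w : Multiset FlowerPos} :
    Move p (star ::ₘ s) w ↔ w = s ∨ ∃ t, Move p s t ∧ w = star ::ₘ t := by
  have h : ∀ u, star.Move p u ↔ u = 0 := by
    intro u
    constructor
    · rintro (⟨_, _, k, hk⟩ | ⟨_, _, y, hy⟩)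
      · obtain rfl : k = 0 := by omega
        simp [stub]
      · exact (Blossom.not_move_empty hy).elim
    · rintro rfl
      have := FlowerPos.Move.stem (p := p) 1 .empty 0 one_pos
      rwa [stub, if_pos rfl] at this
  simp [move_cons_iff, h]

theorem misere_wins_iff {c : FlowerPos} (hc : c ∈ s) (h : 0 < c.height) :
    Wins .misere p s ↔ ∃ t, Move p s t ∧ ¬ Wins .misere p.opp t := by
  obtain ⟨r, rfl⟩ := Multiset.exists_cons_of_mem hc
  rw [Wins]
  simp only [true_and, exists_prop, or_iff_right_iff_imp]
  exact fun h' => (h' _ (move_remove p h)).elim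

theorem misere_wins_zero : Wins .misere p 0 := by
  rw [Wins]
  exact .inl ⟨rfl, fun t => not_move_zero⟩

/-- In normal play of the star plus `s`, a winning removal of the star can be replaced by a winning
move in `s`. This matters because misère play of `s` alone has no star to remove. -/
theorem Nonneg.exists_move_star (hp : Nonneg p s) (hs : AllOne s) (h0 : s ≠ 0) :
    ∃ t, Move p s t ∧ Nonneg p (star ::ₘ t) := by
  by_cases hle : ∃ c ∈ s, c.val p ≤ 0
  · obtain ⟨c, hc, hle⟩ := hle
    obtain ⟨r, rfl⟩ := Multiset.exists_cons_of_mem hc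
    obtain ⟨h, x⟩ := c
    obtain rfl : h = 1 := (allOne_cons.1 hs).1
    -- The star is at least as good for `p` as the removed flower.
    exact ⟨r, move_remove p one_pos, hp.mono (hle.trans (Blossom.val_empty p).ge)⟩
  · push Not at hle
    obtain ⟨c, hc⟩ := Multiset.exists_mem_of_ne_zero h0
    obtain ⟨r, rfl⟩ := Multiset.exists_cons_of_mem hc
    have hs' := allOne_cons.1 hs
    -- All values are positive, so the move need only leave, with the star, an even number of
    -- nonnegative flowers.
    rcases Nat.even_or_odd r.card with he | ho
    · obtain ⟨y, hy, hy0⟩ := Blossom.exists_move_of_pos (hle c hc)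
      refine ⟨_, ⟨c, r, _, rfl, .blossom c.height c.blossom y hy, rfl⟩, ?_⟩
      rw [Multiset.singleton_add]
      refine (Paired.of_nonneg (s := star ::ₘ ⟨c.height, y⟩ ::ₘ r)
        (allOne_cons.2 ⟨rfl, allOne_cons.2 ⟨hs'.1, hs'.2⟩⟩) ?_ ?_).nonneg
      · intro d hd
        simp only [Multiset.mem_cons] at hd
        rcases hd with rfl | rfl | hd
        · exact (star_val p).ge
        · exact hy0
        · exact (hle d (by simp [hd])).le
      · simpa [Nat.even_add_one] using he
    · refine ⟨r, move_remove p (by omega), ?_⟩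
      refine (Paired.of_nonneg (s := star ::ₘ r) (allOne_cons.2 ⟨rfl, hs'.2⟩) ?_ ?_).nonneg
      · intro d hd
        simp only [Multiset.mem_cons] at hd
        rcases hd with rfl | hd
        · exact (star_val p).ge
        · exact (hle d (by simp [hd])).le
      · simpa using ho.add_one

/-- Moves inside `s` match by induction, so only the removal of the star needs care: on the normal
side it is replaced through `exists_move_star`, on the misère side it is traced back to normal play
of the star plus `s`. -/
theorem misere_wins_iff_of_allOne (hs : AllOne s) (p : Player) :
    (Wins .misere p s ↔ Wins .normal p (star ::ₘ s)) ∧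
      (Wins .misere p (star ::ₘ s) ↔ Wins .normal p s) := by
  induction hn : size s using Nat.strong_induction_on generalizing s p with
  | _ n ih =>
  have IH : ∀ p q t, Move p s t → (Wins .misere q t ↔ Wins .normal q (star ::ₘ t)) ∧
      (Wins .misere q (star ::ₘ t) ↔ Wins .normal q t) := fun p q t ht =>
    ih _ (hn ▸ ht.size_lt) (hs.of_move ht) q rfl
  have h1 : ∀ p, Wins .misere p s ↔ Wins .normal p (star ::ₘ s) := by
    intro p
    rw [wins_iff]
    rcases s.empty_or_exists_mem with rfl | ⟨c, hc⟩
    -- With no summand, the misère player wins for lack of a move, and the normal player by taking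
    -- the star.
    · exact iff_of_true misere_wins_zero ⟨0, move_star_cons_iff.2 (.inl rfl), nonneg_zero⟩
    rw [misere_wins_iff hc (by have := hs c hc; omega)]
    have h0 : s ≠ 0 := by rintro rfl; simp at hc
    constructor
    · rintro ⟨t, ht, h⟩
      exact ⟨_, move_star_cons_iff.2 (.inr ⟨t, ht, rfl⟩), (IH p p.opp t ht).1.not.1 h⟩
    · rintro ⟨w, hw, h⟩
      rcases move_star_cons_iff.1 hw with rfl | ⟨t, ht, rfl⟩
      · obtain ⟨t, ht, h'⟩ := h.exists_move_star hs h0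
        exact ⟨t, ht, (IH p p.opp t ht).1.not.2 h'⟩
      · exact ⟨t, ht, (IH p p.opp t ht).1.not.2 h⟩
  refine ⟨h1 p, ?_⟩
  rw [misere_wins_iff (Multiset.mem_cons_self star s) one_pos]
  constructor
  · rintro ⟨w, hw, h⟩
    rcases move_star_cons_iff.1 hw with rfl | ⟨t, ht, rfl⟩
    · rw [h1] at h
      -- Since `p` wins moving second on the star plus `w`, `p` also wins moving first on `w`, which
      -- the opponent could have reached by taking the star.
      exact nonneg_iff.1 h w (move_star_cons_iff.2 (.inl rfl))
    · exact wins_iff.2 ⟨t, ht, (IH p p.opp t ht).2.not.1 h⟩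
  · rw [wins_iff]
    rintro ⟨t, ht, h⟩
    exact ⟨_, move_star_cons_iff.2 (.inr ⟨t, ht, rfl⟩), (IH p p.opp t ht).2.not.2 h⟩

/-- Cutting down the only tall stem can leave no edge of it or exactly one, and whoever can do one
can do the other. -/
theorem Move.tall_or (h0 : ∀ c ∈ s, 0 < c.height) (htall : ∃ c ∈ s, 2 ≤ c.height)
    (h : Move p s t) : (∃ c ∈ t, 2 ≤ c.height) ∨
      ∃ r, AllOne r ∧ (t = r ∨ t = star ::ₘ r) ∧ Move p s r ∧ Move p s (star ::ₘ r) := by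
  obtain ⟨c, r, u, rfl, hu, rfl⟩ := h
  by_cases hr : ∃ d ∈ r, 2 ≤ d.height
  · obtain ⟨d, hd, h2⟩ := hr
    exact .inl ⟨d, by simp [hd], h2⟩
  have hc : 2 ≤ c.height := by
    obtain ⟨d, hd, h2⟩ := htall
    rcases Multiset.mem_cons.1 hd with rfl | hd
    · exact h2
    · exact (hr ⟨d, hd, h2⟩).elim
  push Not at hr
  have hone : AllOne r := fun d hd => by
    have h1 := hr d hd
    have h2 := h0 d (by simp [hd])
    omega
  have hm0 := move_remove p (s := r) (c := c) (by omega)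
  have hm1 : Move p (c ::ₘ r) (star ::ₘ r) :=
    ⟨c, r, _, rfl, .stem c.height c.blossom 1 hc, by simp [stub, star]⟩
  cases hu with
  | stem h x k hk =>
    rcases lt_or_ge k 2 with hk2 | hk2
    · refine .inr ⟨r, hone, ?_, hm0, hm1⟩
      interval_cases k
      · exact .inl (by simp [stub])
      · exact .inr (by simp [stub, star])
    · exact .inl ⟨⟨k, .empty⟩, by simp [stub, show k ≠ 0 by omega], hk2⟩
  | blossom h x y hxy => exact .inl ⟨⟨h, y⟩, by simp, hc⟩

theorem Move.height_pos (h0 : ∀ c ∈ s, 0 < c.height) (h : Move p s t) :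
    ∀ c ∈ t, 0 < c.height := by
  obtain ⟨c, r, u, rfl, hu, rfl⟩ := h
  intro d hd
  rcases Multiset.mem_add.1 hd with hd | hd
  · cases hu with
    | stem h x k hk =>
      unfold stub at hd
      split_ifs at hd with hk0
      · simp at hd
      · rw [Multiset.mem_singleton.1 hd]
        exact Nat.pos_of_ne_zero hk0
    | blossom h x y hxy =>
      rw [Multiset.mem_singleton.1 hd]
      exact h0 ⟨h, x⟩ (by simp)
  · exact h0 d (by simp [hd])

/-- A winning move that keeps a tall flower is used unchanged. One that cuts the last tall flower is
exchanged for its twin, with the star added or dropped, because the conventions are swapped at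
height one. -/
theorem misere_wins_iff_of_tall (h0 : ∀ c ∈ s, 0 < c.height) (htall : ∃ c ∈ s, 2 ≤ c.height)
    (p : Player) : Wins .misere p s ↔ Wins .normal p s := by
  induction hn : size s using Nat.strong_induction_on generalizing s p with
  | _ n ih =>
  obtain ⟨c, hc, h2⟩ := id htall
  rw [wins_iff, misere_wins_iff hc (by omega)]
  constructor
  · rintro ⟨t, ht, h⟩
    rcases ht.tall_or h0 htall with h' | ⟨r, hr, rfl | rfl, h3, h4⟩
    · exact ⟨t, ht, (ih _ (hn ▸ ht.size_lt) (ht.height_pos h0) h' _ rfl).not.1 h⟩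
    · exact ⟨_, h4, (misere_wins_iff_of_allOne hr _).1.not.1 h⟩
    · exact ⟨_, h3, (misere_wins_iff_of_allOne hr _).2.not.1 h⟩
  · rintro ⟨t, ht, h⟩
    rcases ht.tall_or h0 htall with h' | ⟨r, hr, rfl | rfl, h3, h4⟩
    · exact ⟨t, ht, (ih _ (hn ▸ ht.size_lt) (ht.height_pos h0) h' _ rfl).not.2 h⟩
    · exact ⟨_, h4, (misere_wins_iff_of_allOne hr _).2.not.2 h⟩
    · exact ⟨_, h3, (misere_wins_iff_of_allOne hr _).1.not.2 h⟩

end FlowerSum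

/-! ### From graphs to sums of flowers. -/

namespace Hackenbush

open FlowerSum FlowerPos

/-- The moves from a set of edges of `G` correspond to those from the sum of flowers assigned to
it by `φ`. -/
def Represents (G : Hackenbush) (φ : Finset G.E → Multiset FlowerPos) : Prop :=
  ∀ S, G.prune S = S → ∀ p,
    (∀ e ∈ S, p.CanCut (G.color e) → FlowerSum.Move p (φ S) (φ (G.cut S e))) ∧
    ∀ t, FlowerSum.Move p (φ S) t → ∃ e ∈ S, p.CanCut (G.color e) ∧ t = φ (G.cut S e)

variable {G H : Hackenbush}

theorem Represents.winsFirst_iff {φ : Finset G.E → Multiset FlowerPos} (h : G.Represents φ)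
    {S : Finset G.E} (hS : G.prune S = S) (c : Convention) (p : Player) :
    G.WinsFirst c p S ↔ Wins c p (φ S) := by
  induction hn : S.card using Nat.strong_induction_on generalizing S p with
  | _ n ih =>
  have IH : ∀ e ∈ S, G.WinsFirst c p.opp (G.cut S e) ↔ Wins c p.opp (φ (G.cut S e)) :=
    fun e he => ih _ (hn ▸ G.card_cut_lt he) (prune_cut S e) _ rfl
  obtain ⟨h1, h2⟩ := h S hS p
  rw [WinsFirst, Wins]
  refine or_congr (and_congr_right fun _ => ⟨fun h3 t ht => ?_, fun h3 e he hc => ?_⟩)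
    ⟨?_, ?_⟩
  · obtain ⟨e, he, hc, -⟩ := h2 t ht
    exact h3 e he hc
  · exact h3 _ (h1 e he hc)
  · rintro ⟨e, he, hc, hw⟩
    exact ⟨_, h1 e he hc, (IH e he).not.1 hw⟩
  · rintro ⟨t, ht, hw⟩
    obtain ⟨e, he, hc, rfl⟩ := h2 t ht
    exact ⟨e, he, hc, (IH e he).not.2 hw⟩

theorem represents_zero : zero.Represents fun _ => 0 :=
  fun _ _ _ => ⟨fun e => e.elim, fun _ h => (not_move_zero h).elim⟩

/-! ### Disjunctive sums: pruning and cutting act on each summand separately. -/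

section Add

/-- The edges of the left summand as edges of the sum. -/
def edgeInl (e : G.E) : (G.add H).E := Sum.inl e

/-- The edges of the right summand as edges of the sum. -/
def edgeInr (e : H.E) : (G.add H).E := Sum.inr e

/-- The vertices of the left summand as vertices of the sum. -/
def vertInl (v : G.V) : (G.add H).V := Sum.inl v

/-- The vertices of the right summand as vertices of the sum. -/
def vertInr (v : H.V) : (G.add H).V := Sum.inr v

theorem edge_add_cases (e : (G.add H).E) : (∃ a, e = edgeInl a) ∨ ∃ b, e = edgeInr b := by
  rcases e with a | b
  · exact .inl ⟨a, rfl⟩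
  · exact .inr ⟨b, rfl⟩

theorem edgeInl_inj {e f : G.E} : (edgeInl e : (G.add H).E) = edgeInl f ↔ e = f :=
  Sum.inl_injective.eq_iff

theorem edgeInr_inj {e f : H.E} : (edgeInr e : (G.add H).E) = edgeInr f ↔ e = f :=
  Sum.inr_injective.eq_iff

theorem edgeInl_ne_edgeInr {e : G.E} {f : H.E} : (edgeInl e : (G.add H).E) ≠ edgeInr f :=
  Sum.inl_ne_inr

/-- The edges of the left summand. -/
def leftPart (S : Finset (G.add H).E) : Finset G.E := Finset.toLeft (α := G.E) (β := H.E) S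

/-- The edges of the right summand. -/
def rightPart (S : Finset (G.add H).E) : Finset H.E := Finset.toRight (α := G.E) (β := H.E) S

theorem mem_leftPart {S : Finset (G.add H).E} {e : G.E} :
    e ∈ leftPart S ↔ (edgeInl e) ∈ S := Finset.mem_toLeft

theorem mem_rightPart {S : Finset (G.add H).E} {e : H.E} :
    e ∈ rightPart S ↔ (edgeInr e) ∈ S := Finset.mem_toRight

theorem ends_add_inl (e : G.E) :
    (G.add H).ends (edgeInl e) = (G.ends e).map vertInl := rfl

theorem ends_add_inr (e : H.E) :
    (G.add H).ends (edgeInr e) = (H.ends e).map vertInr := rfl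

/-- The vertices of the sum that are connected to the ground within the summands. -/
def AddGrounded (S : Finset (G.add H).E) : (G.add H).V → Prop :=
  Sum.elim (G.Grounded (leftPart S)) (H.Grounded (rightPart S))

theorem Grounded.of_add {S : Finset (G.add H).E} {w : (G.add H).V} (h : (G.add H).Grounded S w) :
    AddGrounded S w := by
  induction h with
  | base v hv =>
    rcases hv with ⟨a, ha, rfl⟩ | ⟨a, ha, rfl⟩
    · exact .base a ha
    · exact .base a ha
  | step u v e he huv hu ih =>
    obtain ⟨e, rfl⟩ | ⟨e, rfl⟩ := edge_add_cases e
    · rw [ends_add_inl] at huv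
      have key : ∀ a b, G.ends e = s(a, b) → G.Grounded (leftPart S) a →
          G.Grounded (leftPart S) b := fun a b h ha => .step a b e (mem_leftPart.2 he) h ha
      induction h : G.ends e with | _ a b
      rw [h, Sym2.map_mk, Sym2.eq_iff] at huv
      rcases huv with ⟨rfl, rfl⟩ | ⟨rfl, rfl⟩
      · exact key a b h ih
      · exact key b a (h.trans Sym2.eq_swap) ih
    · rw [ends_add_inr] at huv
      have key : ∀ a b, H.ends e = s(a, b) → H.Grounded (rightPart S) a →
          H.Grounded (rightPart S) b := fun a b h ha => .step a b e (mem_rightPart.2 he) h ha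
      induction h : H.ends e with | _ a b
      rw [h, Sym2.map_mk, Sym2.eq_iff] at huv
      rcases huv with ⟨rfl, rfl⟩ | ⟨rfl, rfl⟩
      · exact key a b h ih
      · exact key b a (h.trans Sym2.eq_swap) ih

theorem Grounded.add_inl {S : Finset (G.add H).E} {v : G.V} (h : G.Grounded (leftPart S) v) :
    (G.add H).Grounded S (vertInl v) := by
  induction h with
  | base v hv => exact .base _ (.inl ⟨v, hv, rfl⟩)
  | step u v e he huv hu ih =>
    exact .step _ _ (edgeInl e) (mem_leftPart.1 he)
      (by rw [ends_add_inl, huv]; rfl) ih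

theorem Grounded.add_inr {S : Finset (G.add H).E} {v : H.V} (h : H.Grounded (rightPart S) v) :
    (G.add H).Grounded S (vertInr v) := by
  induction h with
  | base v hv => exact .base _ (.inr ⟨v, hv, rfl⟩)
  | step u v e he huv hu ih =>
    exact .step _ _ (edgeInr e) (mem_rightPart.1 he)
      (by rw [ends_add_inr, huv]; rfl) ih

theorem leftPart_prune (S : Finset (G.add H).E) :
    leftPart ((G.add H).prune S) = G.prune (leftPart S) := by
  ext e
  rw [mem_leftPart, mem_prune, mem_prune, mem_leftPart, ends_add_inl]
  refine and_congr_right fun _ => ⟨?_, ?_⟩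
  · rintro ⟨w, hw, h⟩
    obtain ⟨a, ha, rfl⟩ := Sym2.mem_map.1 hw
    exact ⟨a, ha, h.of_add⟩
  · rintro ⟨a, ha, h⟩
    exact ⟨_, Sym2.mem_map.2 ⟨a, ha, rfl⟩, h.add_inl⟩

theorem rightPart_prune (S : Finset (G.add H).E) :
    rightPart ((G.add H).prune S) = H.prune (rightPart S) := by
  ext e
  rw [mem_rightPart, mem_prune, mem_prune, mem_rightPart, ends_add_inr]
  refine and_congr_right fun _ => ⟨?_, ?_⟩
  · rintro ⟨w, hw, h⟩
    obtain ⟨a, ha, rfl⟩ := Sym2.mem_map.1 hw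
    exact ⟨a, ha, h.of_add⟩
  · rintro ⟨a, ha, h⟩
    exact ⟨_, Sym2.mem_map.2 ⟨a, ha, rfl⟩, h.add_inr⟩

theorem leftPart_start : leftPart (G.add H).start = G.start := by
  rw [start, leftPart_prune, start]
  congr 1
  ext e
  exact iff_of_true (mem_leftPart.2 (Finset.mem_univ _)) (Finset.mem_univ _)

theorem rightPart_start : rightPart (G.add H).start = H.start := by
  rw [start, rightPart_prune, start]
  congr 1
  ext e
  exact iff_of_true (mem_rightPart.2 (Finset.mem_univ _)) (Finset.mem_univ _)

open Classical in
theorem leftPart_cut_inl (S : Finset (G.add H).E) (e : G.E) :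
    leftPart ((G.add H).cut S (edgeInl e)) = G.cut (leftPart S) e := by
  rw [cut, leftPart_prune, cut]
  congr 1
  ext f
  rw [mem_leftPart, Finset.mem_erase, Finset.mem_erase, mem_leftPart]
  simp only [ne_eq, edgeInl_inj]

open Classical in
theorem rightPart_cut_inl {S : Finset (G.add H).E} (hS : (G.add H).prune S = S) (e : G.E) :
    rightPart ((G.add H).cut S (edgeInl e)) = rightPart S := by
  rw [cut, rightPart_prune]
  conv_rhs => rw [← hS, rightPart_prune]
  congr 1
  ext f
  rw [mem_rightPart, Finset.mem_erase, mem_rightPart]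
  exact and_iff_right edgeInl_ne_edgeInr.symm

open Classical in
theorem rightPart_cut_inr (S : Finset (G.add H).E) (e : H.E) :
    rightPart ((G.add H).cut S (edgeInr e)) = H.cut (rightPart S) e := by
  rw [cut, rightPart_prune, cut]
  congr 1
  ext f
  rw [mem_rightPart, Finset.mem_erase, Finset.mem_erase, mem_rightPart]
  simp only [ne_eq, edgeInr_inj]

open Classical in
theorem leftPart_cut_inr {S : Finset (G.add H).E} (hS : (G.add H).prune S = S) (e : H.E) :
    leftPart ((G.add H).cut S (edgeInr e)) = leftPart S := by
  rw [cut, leftPart_prune]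
  conv_rhs => rw [← hS, leftPart_prune]
  congr 1
  ext f
  rw [mem_leftPart, Finset.mem_erase, mem_leftPart]
  exact and_iff_right edgeInl_ne_edgeInr

theorem Represents.add {φ : Finset G.E → Multiset FlowerPos} {ψ : Finset H.E → Multiset FlowerPos}
    (hφ : G.Represents φ) (hψ : H.Represents ψ) :
    (G.add H).Represents fun S => φ (leftPart S) + ψ (rightPart S) := by
  intro S hS p
  have hl : G.prune (leftPart S) = leftPart S := by rw [← leftPart_prune, hS]
  have hr : H.prune (rightPart S) = rightPart S := by rw [← rightPart_prune, hS]
  obtain ⟨h1, h2⟩ := hφ _ hl p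
  obtain ⟨h3, h4⟩ := hψ _ hr p
  refine ⟨?_, fun t ht => ?_⟩
  · intro e he hc
    obtain ⟨e, rfl⟩ | ⟨e, rfl⟩ := edge_add_cases e
    · simp only
      rw [leftPart_cut_inl, rightPart_cut_inl hS]
      exact move_add_iff.2 (.inl ⟨_, h1 e (mem_leftPart.2 he) hc, rfl⟩)
    · simp only
      rw [leftPart_cut_inr hS, rightPart_cut_inr]
      exact move_add_iff.2 (.inr ⟨_, h3 e (mem_rightPart.2 he) hc, rfl⟩)
  · rcases move_add_iff.1 ht with ⟨t', h, rfl⟩ | ⟨t', h, rfl⟩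
    · obtain ⟨e, he, hc, rfl⟩ := h2 t' h
      refine ⟨(edgeInl e), mem_leftPart.1 he, hc, ?_⟩
      simp only
      rw [leftPart_cut_inl, rightPart_cut_inl hS]
    · obtain ⟨e, he, hc, rfl⟩ := h4 t' h
      refine ⟨(edgeInr e), mem_rightPart.1 he, hc, ?_⟩
      simp only
      rw [leftPart_cut_inr hS, rightPart_cut_inr]

end Add

/-! ### A single flower: what its stem and its blossom retain. -/

section Stem

variable {n : ℕ} {B : Hackenbush}

/-- The edges of the stem as edges of the flower. -/
def stemEdge (i : Fin n) : (onStem n B).E := Sum.inl i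

/-- The edges of the blossom as edges of the flower. -/
def blossomEdge (e : B.E) : (onStem n B).E := Sum.inr e

/-- The vertices of the stem as vertices of the flower. -/
def stemVert (i : Fin (n + 1)) : (onStem n B).V := Sum.inl i

/-- The vertices of the blossom as vertices of the flower. -/
def freeVert (v : B.V) : (onStem n B).V := Sum.inr v

theorem edge_onStem_cases (e : (onStem n B).E) :
    (∃ i, e = stemEdge i) ∨ ∃ a, e = blossomEdge a := by
  rcases e with a | b
  · exact .inl ⟨a, rfl⟩
  · exact .inr ⟨b, rfl⟩

theorem stemEdge_inj {i j : Fin n} : (stemEdge i : (onStem n B).E) = stemEdge j ↔ i = j :=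
  Sum.inl_injective.eq_iff

theorem blossomEdge_inj {e f : B.E} : (blossomEdge e : (onStem n B).E) = blossomEdge f ↔ e = f :=
  Sum.inr_injective.eq_iff

theorem stemEdge_ne_blossomEdge {i : Fin n} {e : B.E} :
    (stemEdge i : (onStem n B).E) ≠ blossomEdge e :=
  Sum.inl_ne_inr

/-- The edges of the stem. -/
def stemPart (S : Finset (onStem n B).E) : Finset (Fin n) :=
  Finset.toLeft (α := Fin n) (β := B.E) S

/-- The edges of the blossom. -/
def blossomPart (S : Finset (onStem n B).E) : Finset B.E :=
  Finset.toRight (α := Fin n) (β := B.E) S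

theorem mem_stemPart {S : Finset (onStem n B).E} {i : Fin n} :
    i ∈ stemPart S ↔ (stemEdge i) ∈ S := Finset.mem_toLeft

theorem mem_blossomPart {S : Finset (onStem n B).E} {e : B.E} :
    e ∈ blossomPart S ↔ (blossomEdge e) ∈ S := Finset.mem_toRight

open Classical in
/-- The vertex of the flower that corresponds to a vertex of the blossom. -/
noncomputable def attach (n : ℕ) (B : Hackenbush) (v : B.V) : (onStem n B).V :=
  if v ∈ B.ground then stemVert (Fin.last n) else freeVert v

theorem ends_onStem_inl (i : Fin n) : (onStem n B).ends (stemEdge i) =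
    s((stemVert i.castSucc), (stemVert i.succ)) := rfl

theorem ends_onStem_inr (e : B.E) :
    (onStem n B).ends (blossomEdge e) = (B.ends e).map (attach n B) := rfl

/-- A description of the vertices that are connected to the ground. -/
def Attached (S : Finset (onStem n B).E) : (onStem n B).V → Prop :=
  Sum.elim (fun i => ∀ j : Fin n, j.val < i.val → j ∈ stemPart S)
    fun v => v ∉ B.ground ∧ stemPart S = Finset.univ ∧ B.Grounded (blossomPart S) v

/-- Ground vertices of `B` are glued to the top of the stem, where being grounded means that the
whole stem is present; so both cases of `attach` give one criterion. -/
theorem attached_attach {S : Finset (onStem n B).E} {v : B.V} :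
    Attached S (attach n B v) ↔ stemPart S = Finset.univ ∧ B.Grounded (blossomPart S) v := by
  by_cases h : v ∈ B.ground
  · have : B.Grounded (blossomPart S) v := .base v h
    simp only [this, and_true, Finset.eq_univ_iff_forall]
    rw [attach, if_pos h]
    exact forall_congr' fun j => forall_prop_of_true j.2
  · rw [attach, if_neg h]
    exact and_iff_right h

theorem Grounded.attached {S : Finset (onStem n B).E} {w : (onStem n B).V}
    (h : (onStem n B).Grounded S w) : Attached S w := by
  induction h with
  | base v hv =>
    rw [Set.mem_singleton_iff.1 hv]
    intro j hj
    simp at hj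
  | step u v e he huv hu ih =>
    obtain ⟨i, rfl⟩ | ⟨e, rfl⟩ := edge_onStem_cases e
    · rw [ends_onStem_inl, Sym2.eq_iff] at huv
      rcases huv with ⟨rfl, rfl⟩ | ⟨rfl, rfl⟩
      · intro j hj
        rcases (Nat.lt_succ_iff.1 hj).lt_or_eq with h | h
        · exact ih j h
        · rw [Fin.ext h]
          exact mem_stemPart.2 he
      · intro j hj
        exact ih j (hj.trans (Nat.lt_succ_self _))
    · rw [ends_onStem_inr] at huv
      have key : ∀ a b, B.ends e = s(a, b) → Attached S (attach n B a) →
          Attached S (attach n B b) := fun a b h ha => by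
        rw [attached_attach] at ha ⊢
        exact ⟨ha.1, .step a b e (mem_blossomPart.2 he) h ha.2⟩
      induction h : B.ends e with | _ a b
      rw [h, Sym2.map_mk, Sym2.eq_iff] at huv
      rcases huv with ⟨rfl, rfl⟩ | ⟨rfl, rfl⟩
      · exact key a b h ih
      · exact key b a (h.trans Sym2.eq_swap) ih

theorem grounded_stem {S : Finset (onStem n B).E} (i : Fin (n + 1))
    (h : ∀ j : Fin n, j.val < i.val → j ∈ stemPart S) :
    (onStem n B).Grounded S (stemVert i) := by
  induction i using Fin.induction with
  | zero => exact .base _ rfl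
  | succ i ih =>
    exact .step _ _ (stemEdge i) (mem_stemPart.1 (h i (by simp)))
      (ends_onStem_inl i) (ih fun j hj => h j (hj.trans (Nat.lt_succ_self _)))

theorem grounded_attach {S : Finset (onStem n B).E} (hS : stemPart S = Finset.univ) {v : B.V}
    (h : B.Grounded (blossomPart S) v) : (onStem n B).Grounded S (attach n B v) := by
  induction h with
  | base v hv =>
    rw [attach, if_pos hv]
    exact grounded_stem _ fun j _ => by simp [hS]
  | step u v e he huv hu ih =>
    exact .step _ _ (blossomEdge e) (mem_blossomPart.1 he)
      (by rw [ends_onStem_inr, huv]; rfl) ih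

theorem mem_stemPart_prune {S : Finset (onStem n B).E} {i : Fin n} :
    i ∈ stemPart ((onStem n B).prune S) ↔ ∀ j ≤ i, j ∈ stemPart S := by
  rw [mem_stemPart, mem_prune, ends_onStem_inl, ← mem_stemPart]
  constructor
  · rintro ⟨hi, w, hw, h⟩ j hj
    rcases hj.lt_or_eq with hj | rfl
    · rcases Sym2.mem_iff.1 hw with rfl | rfl
      · exact h.attached j hj
      · exact h.attached j (Nat.lt_succ_of_lt hj)
    · exact hi
  · intro h
    exact ⟨h i le_rfl, _, Sym2.mem_mk_left _ _, grounded_stem _ fun j hj => h j hj.le⟩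

theorem mem_blossomPart_prune {S : Finset (onStem n B).E} {e : B.E} :
    e ∈ blossomPart ((onStem n B).prune S) ↔
      stemPart S = Finset.univ ∧ e ∈ B.prune (blossomPart S) := by
  rw [mem_blossomPart, mem_prune, mem_prune, ends_onStem_inr, ← mem_blossomPart]
  constructor
  · rintro ⟨he, w, hw, h⟩
    obtain ⟨a, ha, rfl⟩ := Sym2.mem_map.1 hw
    have := attached_attach.1 h.attached
    exact ⟨this.1, he, a, ha, this.2⟩
  · rintro ⟨hS, he, a, ha, h⟩
    exact ⟨he, _, Sym2.mem_map.2 ⟨a, ha, rfl⟩, grounded_attach hS h⟩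

theorem stemPart_start : stemPart (onStem n B).start = Finset.univ := by
  ext i
  rw [start, mem_stemPart_prune]
  exact iff_of_true (fun j _ => mem_stemPart.2 (Finset.mem_univ _)) (Finset.mem_univ _)

theorem blossomPart_start : blossomPart (onStem n B).start = B.start := by
  ext e
  rw [start, mem_blossomPart_prune, start]
  have h1 : stemPart (Finset.univ : Finset (onStem n B).E) = Finset.univ := by
    ext
    exact iff_of_true (mem_stemPart.2 (Finset.mem_univ _)) (Finset.mem_univ _)
  have h2 : blossomPart (Finset.univ : Finset (onStem n B).E) = Finset.univ := by
    ext
    exact iff_of_true (mem_blossomPart.2 (Finset.mem_univ _)) (Finset.mem_univ _)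
  simp [h1, h2]

open Classical in
/-- The position of a flower given by a set of edges. -/
noncomputable def stemPos (n : ℕ) (B : Hackenbush) (hB : B.IsRedBlue)
    (S : Finset (onStem n B).E) : Multiset FlowerPos :=
  -- Pruning yields a legitimate `Blossom` for arbitrary `S`; it changes nothing when `S` is itself
  -- pruned.
  if stemPart S = Finset.univ then {⟨n, B, hB, B.prune (blossomPart S), prune_prune _⟩}
  else stub (stemPart S).card

/-- A supported stem is an initial segment, so its number of edges, which is all that `stub`
records, determines it. -/
theorem _root_.Fin.lt_card_of_isLowerSet {A : Finset (Fin n)} (hA : IsLowerSet (A : Set (Fin n)))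
    {i : Fin n} : i.val < A.card ↔ i ∈ A := by
  constructor
  · intro h
    by_contra hi
    have : A ⊆ Finset.Iio i := fun j hj => by
      rw [Finset.mem_Iio]
      by_contra hij
      exact hi (hA (not_lt.1 hij) hj)
    have := Finset.card_le_card this
    rw [Fin.card_Iio] at this
    omega
  · intro h
    have : Finset.Iic i ⊆ A := fun j hj => hA (Finset.mem_Iic.1 hj) h
    have := Finset.card_le_card this
    rw [Fin.card_Iic] at this
    omega

theorem stemPos_cut_inl {hB : B.IsRedBlue} {S : Finset (onStem n B).E}
    (hS : (onStem n B).prune S = S) {i : Fin n} (hi : i ∈ stemPart S) :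
    stemPos n B hB ((onStem n B).cut S (stemEdge i)) = stub i := by
  have h : stemPart ((onStem n B).cut S (stemEdge i)) = Finset.Iio i := by
    ext j
    rw [cut, mem_stemPart_prune, Finset.mem_Iio]
    simp only [mem_stemPart, Finset.mem_erase, ne_eq, stemEdge_inj]
    constructor
    · intro h
      by_contra hij
      exact (h i (not_lt.1 hij)).1 rfl
    · intro hij k hk
      refine ⟨(hk.trans_lt hij).ne, ?_⟩
      rw [← mem_stemPart]
      rw [← hS, mem_stemPart_prune] at hi
      exact hi k (hk.trans hij.le)
  rw [stemPos, h, if_neg, Fin.card_Iio]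
  intro h'
  have := Finset.mem_univ i
  rw [← h'] at this
  simp at this

theorem stemPos_cut_inr {hB : B.IsRedBlue} {S : Finset (onStem n B).E}
    (hS : (onStem n B).prune S = S) (hfull : stemPart S = Finset.univ) (e : B.E) :
    stemPos n B hB ((onStem n B).cut S (blossomEdge e)) =
      {⟨n, B, hB, B.cut (B.prune (blossomPart S)) e, prune_prune _⟩} := by
  classical
  have h1 : stemPart (S.erase (blossomEdge e)) = Finset.univ := by
    rw [← hfull]
    ext j
    rw [mem_stemPart, Finset.mem_erase, mem_stemPart]
    exact and_iff_right stemEdge_ne_blossomEdge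
  have h2 : blossomPart (S.erase (blossomEdge e)) = (blossomPart S).erase e := by
    ext f
    rw [mem_blossomPart, Finset.mem_erase, Finset.mem_erase, mem_blossomPart]
    simp only [ne_eq, blossomEdge_inj]
  have h3 : stemPart ((onStem n B).cut S (blossomEdge e)) = Finset.univ := by
    ext i
    rw [cut, mem_stemPart_prune]
    convert iff_of_true _ (Finset.mem_univ i)
    intro j _
    convert Finset.mem_univ j
  have h4 : blossomPart ((onStem n B).cut S (blossomEdge e)) =
      B.cut (B.prune (blossomPart S)) e := by
    have h5 : B.prune (blossomPart S) = blossomPart S := by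
      ext f
      conv_rhs => rw [← hS, mem_blossomPart_prune]
      simp [hfull]
    rw [h5, cut, cut]
    ext f
    rw [mem_blossomPart_prune]
    convert and_iff_right h1 using 3
    convert h2.symm
  rw [stemPos, if_pos h3]
  simp only [h4, prune_cut]

theorem represents_onStem (hB : B.IsRedBlue) :
    (onStem n B).Represents (stemPos n B hB) := by
  intro S hS p
  have hlow : IsLowerSet (stemPart S : Set (Fin n)) := by
    intro i j hji hi
    rw [Finset.mem_coe, ← hS, mem_stemPart_prune] at hi
    exact hi j hji
  have hfullS : ∀ e, e ∈ blossomPart S → stemPart S = Finset.univ ∧ e ∈ B.prune (blossomPart S) := by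
    intro e he
    rwa [← hS, mem_blossomPart_prune] at he
  constructor
  · intro e he hc
    obtain ⟨i, rfl⟩ | ⟨e, rfl⟩ := edge_onStem_cases e
    · have hi := mem_stemPart.2 he
      rw [stemPos_cut_inl hS hi, stemPos]
      split_ifs with h
      · exact move_singleton_iff.2 (.stem _ _ _ i.2)
      · have := (Fin.lt_card_of_isLowerSet hlow).2 hi
        rw [stub, if_neg (by omega)]
        exact move_singleton_iff.2 (.stem _ _ _ this)
    · obtain ⟨h1, h2⟩ := hfullS e (mem_blossomPart.2 he)
      rw [stemPos_cut_inr hS h1, stemPos, if_pos h1]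
      exact move_singleton_iff.2 (.blossom _ _ _ ⟨e, h2, hc, rfl⟩)
  · intro t ht
    have hgreen : ∀ i : Fin n, p.CanCut ((onStem n B).color (stemEdge i)) := by
      intro i
      cases p <;> exact .inr rfl
    rw [stemPos] at ht
    split_ifs at ht with h
    · cases move_singleton_iff.1 ht with
      | stem _ _ k hk =>
        have hi : (⟨k, hk⟩ : Fin n) ∈ stemPart S := by simp [h]
        exact ⟨_, mem_stemPart.1 hi, hgreen _, (stemPos_cut_inl hS hi).symm⟩
      | blossom _ _ y hy =>
        obtain ⟨e, he, hc, rfl⟩ := hy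
        exact ⟨_, mem_blossomPart.1 (prune_subset _ he), hc, (stemPos_cut_inr hS h e).symm⟩
    · rw [stub] at ht
      split_ifs at ht with h0
      · exact (not_move_zero ht).elim
      · cases move_singleton_iff.1 ht with
        | stem _ _ k hk =>
          have hkn : k < n := hk.trans_le ((Finset.card_le_univ _).trans (by simp))
          have hi := (Fin.lt_card_of_isLowerSet hlow (i := ⟨k, hkn⟩)).1 hk
          exact ⟨_, mem_stemPart.1 hi, hgreen _, (stemPos_cut_inl hS hi).symm⟩
        | blossom _ _ y hy => exact (Blossom.not_move_empty hy).elim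

theorem stemPos_start (hB : B.IsRedBlue) :
    stemPos n B hB (onStem n B).start = {⟨n, B, hB, B.start, prune_start⟩} := by
  rw [stemPos, if_pos stemPart_start]
  simp only [blossomPart_start, prune_start]

end Stem

end Hackenbush

/-! ### Lists of Generalized Flowers, trimming and the outcome. -/

/-- The flower as a summand of a sum of flowers. -/
noncomputable def GenFlower.toPos (f : GenFlower) : FlowerPos :=
  ⟨f.height, f.blossom, f.redBlue, f.blossom.start, Hackenbush.prune_start⟩

theorem GenFlower.toPos_val_left (f : GenFlower) : f.toPos.val .left = f.value := rfl

theorem GenFlower.toPos_val_right (f : GenFlower) : f.toPos.val .right = -f.value := rfl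

/-- The multiset of the flowers of a list. -/
noncomputable def posSum (F : List GenFlower) : Multiset FlowerPos := ↑(F.map GenFlower.toPos)

theorem posSum_cons (f : GenFlower) (F : List GenFlower) :
    posSum (f :: F) = f.toPos ::ₘ posSum F := rfl

theorem mem_posSum {F : List GenFlower} {c : FlowerPos} :
    c ∈ posSum F ↔ ∃ f ∈ F, f.toPos = c := by
  simp [posSum]

theorem posSum_perm {F F' : List GenFlower} (h : F.Perm F') : posSum F = posSum F' :=
  Multiset.coe_eq_coe.2 (h.map _)

/-- The play of `G` is the play of the sum `s` of flowers. -/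
def Hackenbush.PlaysAs (G : Hackenbush) (s : Multiset FlowerPos) : Prop :=
  ∃ φ, G.Represents φ ∧ φ G.start = s

theorem Hackenbush.PlaysAs.add {G H : Hackenbush} {s t : Multiset FlowerPos} (hG : G.PlaysAs s)
    (hH : H.PlaysAs t) : (G.add H).PlaysAs (s + t) := by
  obtain ⟨φ, h1, rfl⟩ := hG
  obtain ⟨ψ, h2, rfl⟩ := hH
  refine ⟨_, h1.add h2, ?_⟩
  simp only [leftPart_start, rightPart_start]

theorem GenFlower.playsAs (f : GenFlower) : f.toHackenbush.PlaysAs {f.toPos} :=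
  ⟨_, Hackenbush.represents_onStem f.redBlue, Hackenbush.stemPos_start f.redBlue⟩

theorem Hackenbush.playsAs_star : star.PlaysAs {FlowerSum.star} := by
  have hrb : zero.IsRedBlue := fun e => e.elim
  refine ⟨_, represents_onStem hrb, (stemPos_start hrb).trans ?_⟩
  have h : zero.start = ∅ := Finset.eq_empty_of_forall_notMem fun e => e.elim
  simp only [h]
  rfl

theorem playsAs_flowerSum (F : List GenFlower) : (flowerSum F).PlaysAs (posSum F) := by
  induction F with
  | nil => exact ⟨_, Hackenbush.represents_zero, rfl⟩
  | cons f F ih => exact f.playsAs.add ih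

theorem playsAs_flowerSum_add_star (F : List GenFlower) :
    ((flowerSum F).add Hackenbush.star).PlaysAs (FlowerSum.star ::ₘ posSum F) := by
  have h := (playsAs_flowerSum F).add Hackenbush.playsAs_star
  rwa [add_comm, Multiset.singleton_add] at h

open Classical in
/-- The outcome class, given whether Left wins and whether Right wins when moving first. -/
noncomputable def outcomeOf (l r : Prop) : Outcome :=
  if l then if r then .N else .L else if r then .R else .P

/-- The outcome of a sum of flowers. -/
noncomputable def FlowerSum.outcome (c : Convention) (s : Multiset FlowerPos) : Outcome :=
  outcomeOf (FlowerSum.Wins c .left s) (FlowerSum.Wins c .right s)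

theorem Hackenbush.PlaysAs.outcome_eq {G : Hackenbush} {s : Multiset FlowerPos}
    (h : G.PlaysAs s) (c : Convention) : G.outcome c = FlowerSum.outcome c s := by
  obtain ⟨φ, h, rfl⟩ := h
  change outcomeOf (G.WinsFirst c .left G.start) (G.WinsFirst c .right G.start) = _
  rw [h.winsFirst_iff Hackenbush.prune_start, h.winsFirst_iff Hackenbush.prune_start]
  rfl

namespace FlowerSum

theorem outcome_congr {c d : Convention} {s t : Multiset FlowerPos}
    (h : ∀ p, Wins c p s ↔ Wins d p t) : outcome c s = outcome d t := by
  rw [outcome, outcome, h, h]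

/-- A sum that is paired for both players behaves as zero: each can preserve a win, moving first or
second. -/
theorem wins_add_paired_iff {s z : Multiset FlowerPos} (hz : ∀ p, Paired p z) (p : Player) :
    Wins .normal p (s + z) ↔ Wins .normal p s := by
  refine ⟨fun h => ?_, fun h => h.add_paired (hz p)⟩
  by_contra hs
  have h1 : Nonneg p.opp s := by rwa [Nonneg, Player.opp_opp]
  have h2 := h1.add_paired (hz p.opp)
  rw [Nonneg, Player.opp_opp] at h2
  exact h2 h

theorem pos_opp (p : Player) (s : Multiset FlowerPos) : pos p.opp s = neg p s :=
  Multiset.countP_congr rfl fun c _ => by simp [FlowerPos.val, Blossom.val_opp]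

theorem neg_opp (p : Player) (s : Multiset FlowerPos) : neg p.opp s = pos p s :=
  Multiset.countP_congr rfl fun c _ => by simp [FlowerPos.val, Blossom.val_opp]

end FlowerSum

theorem pos_posSum (F : List GenFlower) :
    FlowerSum.pos .left (posSum F) = (blueFlowers F).length := by
  induction F with
  | nil => rfl
  | cons f F ih =>
    rw [posSum_cons, FlowerSum.pos_cons, ih, blueFlowers, blueFlowers, List.filter_cons,
      GenFlower.toPos_val_left]
    by_cases h : 0 < f.value <;> simp [GenFlower.IsBlue, h]

theorem neg_posSum (F : List GenFlower) :
    FlowerSum.neg .left (posSum F) = (redFlowers F).length := by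
  induction F with
  | nil => rfl
  | cons f F ih =>
    rw [posSum_cons, FlowerSum.neg_cons, ih, redFlowers, redFlowers, List.filter_cons,
      GenFlower.toPos_val_left]
    by_cases h : f.value < 0 <;> simp [GenFlower.IsRed, h]

theorem card_posSum (F : List GenFlower) : (posSum F).card =
    (blueFlowers F).length + (redFlowers F).length + numStalks F := by
  have h : (posSum F).card = F.length := by simp [posSum]
  rw [h]
  clear h
  induction F with
  | nil => rfl
  | cons f F ih =>
    simp only [blueFlowers, redFlowers, numStalks, List.filter_cons, GenFlower.IsBlue,
      GenFlower.IsRed, GenFlower.IsStalk, List.length_cons] at ih ⊢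
    rcases lt_trichotomy f.value 0 with h | h | h
    · simp [h, h.not_gt, h.ne, ih]
      omega
    · simp [h, ih]
      omega
    · simp [h, h.not_gt, h.ne', ih]
      omega

/-- The cancelling pair is `Paired` for both players, contains no Stalk, and has one flower of each
color. -/
theorem RemovesPair.invariants {F F' : List GenFlower} (h : RemovesPair F F') :
    (∀ p, FlowerSum.Wins .normal p (posSum F) ↔ FlowerSum.Wins .normal p (posSum F')) ∧
      numStalks F = numStalks F' ∧ (IsFlowerbed F → IsFlowerbed F') := by
  obtain ⟨f, g, ⟨hf, hg, hh, hv⟩, hperm⟩ := h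
  refine ⟨fun p => ?_, ?_, fun h => ?_⟩
  · have h1 : posSum F = posSum F' + (f.toPos ::ₘ g.toPos ::ₘ 0) := by
      rw [posSum_perm hperm, posSum_cons, posSum_cons, add_comm, Multiset.cons_add,
        Multiset.cons_add, zero_add]
    rw [h1]
    refine FlowerSum.wins_add_paired_iff (fun p => ?_) p
    have h2 : 0 ≤ f.toPos.val p + g.toPos.val p := by
      cases p
      · rw [GenFlower.toPos_val_left, GenFlower.toPos_val_left, hv]
      · rw [GenFlower.toPos_val_right, GenFlower.toPos_val_right]
        linarith
    have h3 := FlowerSum.Paired.cons f.height f.toPos.blossom g.toPos.blossom 0 h2 .zero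
    have h4 : (⟨f.height, g.toPos.blossom⟩ : FlowerPos) = g.toPos := by rw [hh]; rfl
    rwa [h4] at h3
  · have h1 := (hperm.filter fun f => @decide f.IsStalk (Classical.propDecidable _)).length_eq
    rw [numStalks, h1]
    have h2 : ¬ f.IsStalk := fun h => by
      rw [GenFlower.IsStalk] at h
      rw [GenFlower.IsBlue] at hf
      linarith
    have h3 : ¬ g.IsStalk := fun h => by
      rw [GenFlower.IsStalk] at h
      rw [GenFlower.IsRed] at hg
      linarith
    simp [numStalks, h2, h3]
  · rw [IsFlowerbed, ← pos_posSum, ← neg_posSum] at h ⊢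
    have h5 : 0 < f.value := hf
    have h6 : g.value < 0 := hg
    rw [posSum_perm hperm, posSum_cons, posSum_cons] at h
    simpa [FlowerSum.pos_cons, FlowerSum.neg_cons, GenFlower.toPos_val_left, h5, h6, h5.not_gt,
      h6.not_gt] using h

theorem removesPairs_invariants {F T : List GenFlower}
    (h : Relation.ReflTransGen RemovesPair F T) :
    (∀ p, FlowerSum.Wins .normal p (posSum F) ↔ FlowerSum.Wins .normal p (posSum T)) ∧
      numStalks F = numStalks T ∧ (IsFlowerbed F → IsFlowerbed T) := by
  induction h with
  | refl => exact ⟨fun _ => Iff.rfl, rfl, id⟩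
  | tail _ h ih =>
    have h' := h.invariants
    exact ⟨fun p => (ih.1 p).trans (h'.1 p), ih.2.1.trans h'.2.1, h'.2.2 ∘ ih.2.2⟩

theorem mem_blueFlowers {F : List GenFlower} {f : GenFlower} :
    f ∈ blueFlowers F ↔ f ∈ F ∧ 0 < f.value := by
  classical
  rw [blueFlowers, List.mem_filter, decide_eq_true_iff, GenFlower.IsBlue]

theorem mem_redFlowers {F : List GenFlower} {f : GenFlower} :
    f ∈ redFlowers F ↔ f ∈ F ∧ f.value < 0 := by
  classical
  rw [redFlowers, List.mem_filter, decide_eq_true_iff, GenFlower.IsRed]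

theorem exists_removesPair {T : List GenFlower} {f g : GenFlower} (hf : f ∈ T) (hg : g ∈ T)
    (h : f.Cancels g) : ∃ T', RemovesPair T T' := by
  classical
  have hne : g ≠ f := by
    rintro rfl
    exact lt_asymm h.1 h.2.1
  exact ⟨(T.erase f).erase g, f, g, h, (List.perm_cons_erase hf).trans
    ((List.perm_cons_erase ((List.mem_erase_of_ne hne).2 hg)).cons f)⟩

theorem FlowerSum.Ahead.wins_and_not_wins {p : Player} {s : Multiset FlowerPos}
    (h : FlowerSum.Ahead p s) (hs : FlowerSum.AllOne s) (hb : FlowerSum.pos p s = FlowerSum.neg p s)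
    (he : Even s.card) : FlowerSum.Wins .normal p s ∧ ¬ FlowerSum.Wins .normal p.opp s :=
  ⟨h.wins_of_even hs hb he, h.nonneg_of_even hs hb he⟩

theorem outcome_posSum_of_trimmed {T : List GenFlower} (hT : IsFlowerbed T)
    (htrim : ∀ T', ¬ RemovesPair T T') (hheight : ∀ f ∈ T, f.height = 1) :
    FlowerSum.outcome .normal (posSum T) = predictedOutcome (numStalks T) (flowerEdge T) := by
  have hone : FlowerSum.AllOne (posSum T) := fun c hc => by
    obtain ⟨f, hf, rfl⟩ := mem_posSum.1 hc
    exact hheight f hf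
  have hcard := card_posSum T
  rw [IsFlowerbed] at hT
  have hb : FlowerSum.pos .left (posSum T) = FlowerSum.neg .left (posSum T) := by
    rw [pos_posSum, neg_posSum, hT]
  have hb' : FlowerSum.pos .right (posSum T) = FlowerSum.neg .right (posSum T) := by
    have h1 := FlowerSum.pos_opp .left (posSum T)
    have h2 := FlowerSum.neg_opp .left (posSum T)
    exact h1.trans (hb.symm.trans h2.symm)
  rw [predictedOutcome]
  -- As blue and red are equally many, the Stalks and all summands have the same parity.
  by_cases ha : numStalks T % 2 = 1
  · have ho : Odd (posSum T).card := by
      rw [Nat.odd_iff]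
      omega
    have h1 := FlowerSum.wins_of_odd hone hb ho
    have h2 := FlowerSum.wins_of_odd hone hb' ho
    rw [if_pos ha, FlowerSum.outcome, outcomeOf, if_pos h1, if_pos h2]
  rw [if_neg ha]
  have he : Even (posSum T).card := by
    rw [Nat.even_iff]
    omega
  rcases Nat.eq_zero_or_pos (blueFlowers T).length with h0 | h0
  · have h1 : flowerEdge T = 0 := by
      rw [flowerEdge, List.eq_nil_of_length_eq_zero h0]
      rfl
    have h2 := pos_posSum T
    have h3 : FlowerSum.Nonneg .left (posSum T) :=
      FlowerSum.nonneg_of_even hone (by omega) (by omega) he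
    have h4 : FlowerSum.Nonneg .right (posSum T) := by
      have := FlowerSum.pos_opp .left (posSum T)
      rw [Player.opp] at this
      exact FlowerSum.nonneg_of_even hone (by omega) (by omega) he
    have h3' : ¬ FlowerSum.Wins .normal .right (posSum T) := h3
    have h4' : ¬ FlowerSum.Wins .normal .left (posSum T) := h4
    rw [if_pos h1, FlowerSum.outcome, outcomeOf, if_neg h4', if_neg h3']
  obtain ⟨x, hx⟩ : ∃ x, ((blueFlowers T).map fun f => f.value).min? = some x := by
    rw [← Option.isSome_iff_exists, List.isSome_min?_iff]
    intro h
    rw [List.map_eq_nil_iff.1 h] at h0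
    simp at h0
  obtain ⟨y, hy⟩ : ∃ y, ((redFlowers T).map fun f => -f.value).min? = some y := by
    rw [← Option.isSome_iff_exists, List.isSome_min?_iff]
    intro h
    rw [hT, List.map_eq_nil_iff.1 h] at h0
    simp at h0
  have hedge : flowerEdge T = x - y := by
    rw [flowerEdge, hx, hy]
  obtain ⟨hx1, hx2⟩ := List.min?_eq_some_iff.1 hx
  obtain ⟨hy1, hy2⟩ := List.min?_eq_some_iff.1 hy
  obtain ⟨f, hf, rfl⟩ := List.mem_map.1 hx1
  obtain ⟨g, hg, rfl⟩ := List.mem_map.1 hy1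
  have hf' := mem_blueFlowers.1 hf
  have hg' := mem_redFlowers.1 hg
  -- With edge zero, the minimal flowers `f` and `g`, both of height 1, would cancel.
  have hne : flowerEdge T ≠ 0 := fun h => by
    obtain ⟨T', h'⟩ := exists_removesPair hf'.1 hg'.1 ⟨hf'.2, hg'.2,
      (hheight f hf'.1).trans (hheight g hg'.1).symm, by linarith⟩
    exact htrim T' h'
  rw [if_neg hne]
  by_cases hpos : 0 < flowerEdge T
  · have hA : FlowerSum.Ahead .left (posSum T) := by
      -- The red flower of least absolute value is outweighed by every blue one.
      refine ⟨g.toPos, mem_posSum.2 ⟨g, hg'.1, rfl⟩, hg'.2, fun b hb hb0 => ?_⟩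
      obtain ⟨f', hf1, rfl⟩ := mem_posSum.1 hb
      rw [GenFlower.toPos_val_left] at hb0
      have := hx2 _ (List.mem_map.2 ⟨f', mem_blueFlowers.2 ⟨hf1, hb0⟩, rfl⟩)
      rw [GenFlower.toPos_val_left, GenFlower.toPos_val_left]
      linarith
    obtain ⟨h1, h2⟩ := hA.wins_and_not_wins hone hb he
    rw [Player.opp] at h2
    rw [if_pos hpos, FlowerSum.outcome, outcomeOf, if_pos h1, if_neg h2]
  · have hA : FlowerSum.Ahead .right (posSum T) := by
      refine ⟨f.toPos, mem_posSum.2 ⟨f, hf'.1, rfl⟩, ?_, fun b hb hb0 => ?_⟩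
      · rw [GenFlower.toPos_val_right]
        linarith
      obtain ⟨g', hg1, rfl⟩ := mem_posSum.1 hb
      rw [GenFlower.toPos_val_right] at hb0
      have := hy2 _ (List.mem_map.2 ⟨g', mem_redFlowers.2 ⟨hg1, by linarith⟩, rfl⟩)
      rw [GenFlower.toPos_val_right, GenFlower.toPos_val_right]
      have := (not_lt.1 hpos).lt_of_ne hne
      linarith
    obtain ⟨h1, h2⟩ := hA.wins_and_not_wins hone hb' he
    rw [Player.opp] at h2
    rw [if_neg hpos, FlowerSum.outcome, outcomeOf, if_neg h2, if_pos h1]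

theorem outcome_normal_flowerSum (F : List GenFlower) :
    (flowerSum F).outcome .normal = FlowerSum.outcome .normal (posSum F) :=
  (playsAs_flowerSum F).outcome_eq _

theorem outcome_misere_flowerSum_add_star {F : List GenFlower} (h : ∀ f ∈ F, f.height = 1) :
    ((flowerSum F).add Hackenbush.star).outcome .misere =
      FlowerSum.outcome .normal (posSum F) := by
  rw [(playsAs_flowerSum_add_star F).outcome_eq]
  refine FlowerSum.outcome_congr fun p => (FlowerSum.misere_wins_iff_of_allOne ?_ p).2
  intro c hc
  obtain ⟨f, hf, rfl⟩ := mem_posSum.1 hc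
  exact h f hf

theorem outcome_misere_evilTwin (F : List GenFlower) :
    (evilTwin F).outcome .misere = FlowerSum.outcome .normal (posSum F) := by
  rw [evilTwin]
  split_ifs with h
  · rw [(playsAs_flowerSum F).outcome_eq]
    refine FlowerSum.outcome_congr (FlowerSum.misere_wins_iff_of_tall (fun c hc => ?_) ?_)
    · obtain ⟨f, -, rfl⟩ := mem_posSum.1 hc
      exact f.height_pos
    · obtain ⟨f, hf, h⟩ := h
      exact ⟨f.toPos, mem_posSum.2 ⟨f, hf, rfl⟩, h⟩
  · refine outcome_misere_flowerSum_add_star fun f hf => ?_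
    push Not at h
    have h1 := h f hf
    have h2 := f.height_pos
    omega

theorem theorem4p16 (F T : List GenFlower) (hF : IsFlowerbed F) (hT : IsTrimmedForm F T)
    (hheight : ∀ f ∈ T, f.height = 1) :
    (flowerSum F).outcome .normal = predictedOutcome (numStalks F) (flowerEdge T) ∧
    (evilTwin F).outcome .misere = predictedOutcome (numStalks F) (flowerEdge T) ∧
    (flowerSum T).outcome .normal = predictedOutcome (numStalks F) (flowerEdge T) ∧
    ((flowerSum T).add Hackenbush.star).outcome .misere =
      predictedOutcome (numStalks F) (flowerEdge T) := by
  obtain ⟨h1, h2, h3⟩ := removesPairs_invariants hT.1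
  have h4 := outcome_posSum_of_trimmed (h3 hF) hT.2 hheight
  rw [outcome_normal_flowerSum, outcome_misere_evilTwin, outcome_normal_flowerSum,
    outcome_misere_flowerSum_add_star hheight, FlowerSum.outcome_congr h1, h4, h2]
  exact ⟨rfl, rfl, rfl, rfl⟩
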